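/- Let $G=SU(1,1)=\left\{\begin{pmatrix}\alpha&\beta\\ \bar\beta&\bar\alpha\end{pmatrix}:|\alpha|^2-|\beta|^2=1\right\}$ and put $$u_\theta=\begin{pmatrix}e^{i\theta/2}&0\\0&e^{-i\theta/2}\end{pmatrix},\quad d_t=\begin{pmatrix}\cosh\frac t2&\sinh\frac t2\\ \sinh\frac t2&\cosh\frac t2\end{pmatrix},\quad n_\xi=\begin{pmatrix}1+\frac{i\xi}2&-\frac{i\xi}2\\ \frac{i\xi}2&1-\frac{i\xi}2\end{pmatrix}\qquad(\theta,t,\xi\in\mathbb R),$$ $K=\{u_\theta\}$, $A=\{d_t\}$, $N=\{n_\xi\}$. Let $\mathfrak a=\mathbb R S_x$, $S_x=\frac12\begin{pmatrix}0&1\\1&0\end{pmatrix}$, be the Lie algebra of $A$, so that $\log d_t=tS_x$; let $\rho(tS_x)=t/2$, and let $\mu:\mathfrak a\to\mathbb C$ be an $\mathbb R$-linear form. Write $h^{\lambda}=e^{\lambda(\log h)}$ for $h\in A$ and a linear form $\lambda$ on $\mathfrak a$. For $n\in\frac12\mathbb Z$ let $\chi_n(u_\theta)=e^{in\theta}$,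 and let $\mathcal K_n^\natural(G)$ be the space of continuous compactly supported $f:G\to\mathbb C$ with $f(kgk')=\chi_n(k)f(g)\chi_n(k')$ for all $k,k'\in K$, $g\in G$. Let $h$ be a real number (Planck's constant), $\hbar=h/2\pi$, and let $dg$ be the measure $$\int_G f(g)\,dg=\frac1{4\pi}\int_0^{4\pi}\int_{\mathbb R}\int_{\mathbb R}f(u_\theta d_tn_\xi)\,e^t\,d\xi\,dt\,d\theta .$$ For $f\in\mathcal K_n^\natural(G)$ define the generalised Abel transform and the spherical Fourier transform of type $\chi_n$ by $$F_f^{\langle n\rangle}(t)=\frac{\hbar e^{t/2}}{4\pi}\int_0^{4\pi}\int_{\mathbb R}f(u_\theta d_tn_\xi)e^{-in\theta}\,d\xi\,d\theta,\qquad \phi_n^\mu(f)=\int_{\mathbb R}F_f^{\langle n\rangle}(t)\,e^{t/2}\,e^{\mu(\log d_t)}\,dt .$$ **Theorem.** (1) $dg$ is a Haar measure on $G$. (2) For every $f\in\mathcal K_n^\natural(G)$ the integrals defining $F_f^{\langle n\rangle}$ and $\phi_n^\mu(f)$, and the following one, converge absolutely, and $$\phi_n^\mu(f)=\frac{h}{8\pi^2}\int_G\int_0^{4\pi}\left(\frac{-\beta\zeta+\bar\alpha}{|\bar\alpha-\beta\zeta|}\right)^{2n}f(g)\,\exp[\mu(\log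 d_t)]\,d\theta\,dg,$$ where $\zeta=e^{i\theta}$, $g=\begin{pmatrix}\alpha&\beta\\ \bar\beta&\bar\alpha\end{pmatrix}$ and $t=t(g,\theta)$ is given by $e^t=|\bar\alpha-\beta\zeta|^2$. (3) If $\hbar=1$, then $\phi_n^\mu$ is a Kangni-type transform of type $\chi_n$, that is: (a) for all $f\in\mathcal K_n^\natural(G)$, $$\phi_n^\mu(f)=\int_A F_f^{\chi_n}(h)\,h^{\mu+\rho}\,dh,\qquad F_f^{\chi_n}(h)=h^{\rho}\int_K\int_N f(khn)\,\chi_n(k^{-1})\,dn\,dk,$$ with $dk=\frac1{4\pi}d\theta$ ($0\le\theta<4\pi$), $dh=dt$, $dn=d\xi$; (b) $\phi_n^\mu$ is a spherical Fourier transformation of type $\chi_n$: there is a spherical function $\Phi:G\to\mathbb C$ of type $\chi_n$ with $\phi_n^\mu(f)=\int_Gf(x)\Phi(x^{-1})\,dx$ for all $f\in\mathcal K_n^\natural(G)$. Here $\Phi$ is called spherical of type $\chi_n$ if it is continuous; quasi-bounded, i.e. $|\Phi|\le C r$ for a constant $C$ and some positive lower semicontinuous function $r$ on $G$ that is bounded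 on compact sets and satisfies $r(xy)\le r(x)r(y)$; $\Phi(kxk^{-1})=\Phi(x)$ for $k\in K$; $\chi_n*\Phi=\Phi=\Phi*\chi_n$ (convolution over $K$); and $\mathcal K_n^\natural(G)$ is closed under convolution and $f\mapsto\int_Gf(x)\Phi(x^{-1})\,dx$ is a nonzero multiplicative functional on this convolution algebra (an irreducible representation on $\mathbb C$). -/

import Mathlib

open MeasureTheory Matrix

noncomputable section

namespace QuasiBoson

/-- `σ_z`, the Gram matrix of the Hermitian form `|x₁|² - |x₂|²`. -/
def sigmaZ : Matrix (Fin 2) (Fin 2) ℂ := !![1, 0; 0, -1]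

/-- The matrix underlying an element of `SL(2,ℂ)`. -/
def slMat (g : SpecialLinearGroup (Fin 2) ℂ) : Matrix (Fin 2) (Fin 2) ℂ := g.1

theorem slMat_mul (g g' : SpecialLinearGroup (Fin 2) ℂ) : slMat (g * g') = slMat g * slMat g' := rfl

theorem slMat_one : slMat 1 = 1 := rfl

/-- The group `SU(1,1)`: complex `2 × 2` matrices `g` with `det g = 1` and `gᴴ σ_z g = σ_z`. -/
def SU11 : Subgroup (SpecialLinearGroup (Fin 2) ℂ) where
  carrier := {g | (slMat g)ᴴ * sigmaZ * slMat g = sigmaZ}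
  one_mem' := by
    change (slMat 1)ᴴ * sigmaZ * slMat 1 = sigmaZ
    simp [slMat_one]
  mul_mem' := by
    intro a b ha hb
    change (slMat a)ᴴ * sigmaZ * slMat a = sigmaZ at ha
    change (slMat b)ᴴ * sigmaZ * slMat b = sigmaZ at hb
    change (slMat (a * b))ᴴ * sigmaZ * slMat (a * b) = sigmaZ
    calc _ = (slMat b)ᴴ * ((slMat a)ᴴ * sigmaZ * slMat a) * slMat b := by
          simp only [slMat_mul, conjTranspose_mul, Matrix.mul_assoc]
      _ = sigmaZ := by rw [ha, hb]
  inv_mem' := by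
    intro a ha
    change (slMat a)ᴴ * sigmaZ * slMat a = sigmaZ at ha
    change (slMat a⁻¹)ᴴ * sigmaZ * slMat a⁻¹ = sigmaZ
    have h1 : slMat a * slMat a⁻¹ = 1 := by
      rw [← slMat_mul, mul_inv_cancel, slMat_one]
    have h2 : (slMat a⁻¹)ᴴ * (slMat a)ᴴ = 1 := by
      rw [← conjTranspose_mul, h1, conjTranspose_one]
    calc (slMat a⁻¹)ᴴ * sigmaZ * slMat a⁻¹
        = (slMat a⁻¹)ᴴ * ((slMat a)ᴴ * sigmaZ * slMat a) * slMat a⁻¹ := by rw [ha]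
      _ = ((slMat a⁻¹)ᴴ * (slMat a)ᴴ) * sigmaZ * (slMat a * slMat a⁻¹) := by
          simp only [Matrix.mul_assoc]
      _ = sigmaZ := by rw [h1, h2, Matrix.one_mul, Matrix.mul_one]

instance : MeasurableSpace SU11 := borel SU11

instance : BorelSpace SU11 := ⟨rfl⟩

/-- The matrix underlying an element of `SU(1,1)`. -/
def mat (g : SU11) : Matrix (Fin 2) (Fin 2) ℂ := slMat (g : SpecialLinearGroup (Fin 2) ℂ)

/-- The entry `α` of `g = (α β; β̄ ᾱ)`. -/
def alpha (g : SU11) : ℂ := mat g 0 0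

/-- The entry `β` of `g = (α β; β̄ ᾱ)`. -/
def beta (g : SU11) : ℂ := mat g 0 1

/-- The element `(α β; β̄ ᾱ)` of `SU(1,1)`, for `|α|² - |β|² = 1`. -/
def mk (a b : ℂ) (h : a * star a - b * star b = 1) : SU11 :=
  ⟨⟨!![a, b; star b, star a], by rw [det_fin_two_of]; exact h⟩, by
    change (!![a, b; star b, star a])ᴴ * sigmaZ * !![a, b; star b, star a] = sigmaZ
    ext i j
    fin_cases i <;> fin_cases j <;>
      simp [sigmaZ, Matrix.mul_apply, Fin.sum_univ_two] <;> simp only [Complex.star_def] at h <;>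
      first | (linear_combination h) | (linear_combination -h) | skip
    all_goals ring⟩

theorem mat_mk (a b : ℂ) (h : a * star a - b * star b = 1) :
    mat (mk a b h) = !![a, b; star b, star a] := rfl

theorem ext_mat {g g' : SU11} (h : mat g = mat g') : g = g' := Subtype.ext (Subtype.ext h)

theorem mat_mul (g g' : SU11) : mat (g * g') = mat g * mat g' := rfl

/-- `u_θ = diag (exp (iθ/2), exp (-iθ/2))`. -/
def u (θ : ℝ) : SU11 := mk (Complex.exp (Complex.I * (θ / 2 : ℝ))) 0 (by
  rw [Complex.star_def, ← Complex.exp_conj, ← Complex.exp_add, map_mul, Complex.conj_I,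
    Complex.conj_ofReal]
  simp)

/-- `d_t = (cosh (t/2) sinh (t/2); sinh (t/2) cosh (t/2))`. -/
def d (t : ℝ) : SU11 := mk (Real.cosh (t / 2)) (Real.sinh (t / 2)) (by
  simp only [Complex.star_def, Complex.conj_ofReal]
  norm_cast
  nlinarith [Real.cosh_sq (t / 2)])

/-- `n_ξ = (1 + iξ/2, -iξ/2; iξ/2, 1 - iξ/2)`. -/
def nil (ξ : ℝ) : SU11 := mk (1 + Complex.I * (ξ / 2 : ℝ)) (-(Complex.I * (ξ / 2 : ℝ))) (by
  simp only [Complex.star_def, map_add, map_neg, map_mul, map_one, Complex.conj_I,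
    Complex.conj_ofReal]
  ring)

theorem u_add (a b : ℝ) : u (a + b) = u a * u b := by
  apply ext_mat
  rw [mat_mul, u, u, u, mat_mk, mat_mk, mat_mk]
  have h : Complex.exp (Complex.I * ((a + b) / 2 : ℝ))
      = Complex.exp (Complex.I * (a / 2 : ℝ)) * Complex.exp (Complex.I * (b / 2 : ℝ)) := by
    rw [← Complex.exp_add]; congr 1; push_cast; ring
  ext i j
  rw [h]
  fin_cases i <;> fin_cases j <;> simp [Matrix.mul_apply, Fin.sum_univ_two]

theorem d_add (a b : ℝ) : d (a + b) = d a * d b := by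
  apply ext_mat
  rw [mat_mul, d, d, d, mat_mk, mat_mk, mat_mk, add_div, Real.cosh_add, Real.sinh_add]
  ext i j
  fin_cases i <;> fin_cases j <;>
    simp only [Matrix.mul_apply, Fin.sum_univ_two, Complex.star_def, Complex.conj_ofReal] <;>
    simp <;> ring

theorem nil_add (a b : ℝ) : nil (a + b) = nil a * nil b := by
  apply ext_mat
  rw [mat_mul, nil, nil, nil, mat_mk, mat_mk, mat_mk]
  ext i j
  fin_cases i <;> fin_cases j <;>
    simp [Matrix.mul_apply, Fin.sum_univ_two] <;> ring

/-- The range of a one-parameter family with `φ (a + b) = φ a * φ b`, as a subgroup. -/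
def oneParam (φ : ℝ → SU11) (h : ∀ a b, φ (a + b) = φ a * φ b) : Subgroup SU11 :=
  (MonoidHom.mk' (fun x : Multiplicative ℝ => φ x.toAdd) (fun a b => h a.toAdd b.toAdd)).range

theorem mem_oneParam (φ : ℝ → SU11) (h : ∀ a b, φ (a + b) = φ a * φ b) (x : ℝ) :
    φ x ∈ oneParam φ h := ⟨Multiplicative.ofAdd x, rfl⟩

/-- The compact group `K = {u_θ}`. -/
def K : Subgroup SU11 := oneParam u u_add

/-- The abelian group `A = {d_t}`. -/
def A : Subgroup SU11 := oneParam d d_add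

/-- The nilpotent group `N = {n_ξ}`. -/
def N : Subgroup SU11 := oneParam nil nil_add

def uK (θ : ℝ) : K := ⟨u θ, mem_oneParam u u_add θ⟩

def dA (t : ℝ) : A := ⟨d t, mem_oneParam d d_add t⟩

def nilN (ξ : ℝ) : N := ⟨nil ξ, mem_oneParam nil nil_add ξ⟩

/-- The generator `S_x = σ_x / 2` of the Lie algebra of `A`. -/
def Sx : Matrix (Fin 2) (Fin 2) ℂ := !![0, 1 / 2; 1 / 2, 0]

/-- The Lie algebra `𝔞 = ℝ S_x` of `A`. -/
def LieA : Submodule ℝ (Matrix (Fin 2) (Fin 2) ℂ) := Submodule.span ℝ {Sx}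

/-- The logarithm `A → 𝔞`, `log d_t = t S_x` (note `α + β = exp (t/2)` for `d_t`);
see `logA_dA` and `exp_logA`. -/
def logA (h : A) : LieA :=
  ⟨(2 * Real.log (alpha (h : SU11) + beta (h : SU11)).re) • Sx,
    Submodule.smul_mem _ _ (Submodule.mem_span_singleton_self Sx)⟩

theorem logA_dA (t : ℝ) : (logA (dA t) : Matrix (Fin 2) (Fin 2) ℂ) = t • Sx := by
  have : (alpha (d t) + beta (d t)).re = Real.exp (t / 2) := by
    simp only [alpha, beta, d, mat_mk]
    rw [← Real.cosh_add_sinh]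
    simp only [of_apply, cons_val', cons_val_zero, cons_val_one, cons_val_fin_one,
      Complex.add_re, Complex.ofReal_re]
  simp only [logA, dA, this, Real.log_exp]
  congr 1
  ring

/-- `logA` inverts the exponential map of matrices. -/
theorem exp_logA (h : A) :
    NormedSpace.exp (logA h : Matrix (Fin 2) (Fin 2) ℂ) = mat (h : SU11) := by
  obtain ⟨h, ⟨t, rfl⟩⟩ := h
  change NormedSpace.exp (logA (dA t.toAdd) : Matrix (Fin 2) (Fin 2) ℂ) = mat (d t.toAdd)
  generalize t.toAdd = t
  rw [logA_dA]
  have hdet : (!![1, 1; 1, -1] : Matrix (Fin 2) (Fin 2) ℂ) * !![1 / 2, 1 / 2; 1 / 2, -(1 / 2)] = 1 := by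
    ext i j
    fin_cases i <;> fin_cases j <;> simp [Matrix.mul_apply, Fin.sum_univ_two] <;> norm_num
  have hinv := Matrix.inv_eq_right_inv hdet
  have hu : IsUnit (!![1, 1; 1, -1] : Matrix (Fin 2) (Fin 2) ℂ) :=
    (Matrix.isUnit_iff_isUnit_det _).2 (by rw [det_fin_two_of]; norm_num)
  have hD : ∀ a b : ℂ, diagonal ![a, b] = !![a, 0; 0, b] := by
    intro a b
    ext i j
    fin_cases i <;> fin_cases j <;> simp
  have hS : t • Sx = !![1, 1; 1, -1] * diagonal ![(t / 2 : ℂ), -(t / 2 : ℂ)] *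
      (!![1, 1; 1, -1] : Matrix (Fin 2) (Fin 2) ℂ)⁻¹ := by
    rw [hinv, hD]
    ext i j
    fin_cases i <;> fin_cases j <;>
      simp [Sx, Matrix.mul_apply, Fin.sum_univ_two] <;> ring
  have e : NormedSpace.exp ![(t / 2 : ℂ), -(t / 2 : ℂ)] =
      ![Complex.exp (t / 2), Complex.exp (-(t / 2))] := by
    funext i
    rw [Pi.coe_exp]
    fin_cases i <;> simp [Complex.exp_eq_exp_ℂ]
  rw [hS, Matrix.exp_conj _ _ hu, Matrix.exp_diagonal, hinv, e, hD, d, mat_mk]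
  simp only [Complex.star_def, Complex.conj_ofReal]
  push_cast
  ext i j
  fin_cases i <;> fin_cases j <;>
    simp [Matrix.mul_apply, Fin.sum_univ_two, Complex.cosh, Complex.sinh] <;> ring

/-- Half the positive root: `ρ (t S_x) = t / 2`; see `lie_LieA`. -/
def rho : LieA →ₗ[ℝ] ℝ where
  toFun X := ((X : Matrix (Fin 2) (Fin 2) ℂ) 0 1).re
  map_add' X Y := by simp
  map_smul' c X := by simp

/-- `[X, E] = 2 ρ(X) E` for `X ∈ 𝔞` and the generator `E` of the Lie algebra of `N`. -/
theorem lie_LieA (X : LieA) :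
    let E : Matrix (Fin 2) (Fin 2) ℂ :=
      !![Complex.I / 2, -(Complex.I / 2); Complex.I / 2, -(Complex.I / 2)]
    (X : Matrix (Fin 2) (Fin 2) ℂ) * E - E * X = (2 * rho X) • E := by
  obtain ⟨X, hX⟩ := X
  obtain ⟨t, rfl⟩ := Submodule.mem_span_singleton.1 hX
  have hr : rho ⟨t • Sx, hX⟩ = t / 2 := by
    change ((t • Sx) 0 1).re = t / 2
    simp [Sx]
    ring
  rw [hr]
  ext i j
  fin_cases i <;> fin_cases j <;>
    simp [Sx, Matrix.mul_apply, Fin.sum_univ_two] <;> ring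

/-- The character `χ_n` of `K` for `n = m / 2 ∈ ½ℤ`, i.e. `χ_n (u_θ) = exp (i n θ)`;
see `chi_uK`. -/
def chi (m : ℤ) (k : K) : ℂ := alpha (k : SU11) ^ m

theorem chi_uK (m : ℤ) (θ : ℝ) :
    chi m (uK θ) = Complex.exp (Complex.I * ((m : ℂ) / 2) * θ) := by
  change (Complex.exp (Complex.I * (θ / 2 : ℝ))) ^ m = _
  rw [← Complex.exp_int_mul]
  congr 1
  push_cast
  ring

/-- The space `K_n^♮(G)`, `n = m / 2`: continuous compactly supported functions `f` with
`f (k g k') = χ_n(k) f(g) χ_n(k')` (in particular `f (k g k⁻¹) = f g`). -/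
def KNat (m : ℤ) : Set (SU11 → ℂ) :=
  {f | Continuous f ∧ HasCompactSupport f ∧
    ∀ (k k' : K) (g : SU11), f ((k : SU11) * g * (k' : SU11)) = chi m k * f g * chi m k'}

/-- The Haar measure `dg = (1/4π) exp t dθ dt dξ` in the coordinates `g = u_θ d_t n_ξ`,
`0 ≤ θ < 4π`. -/
def haarG : Measure SU11 :=
  ENNReal.ofReal (1 / (4 * Real.pi)) •
    Measure.map (fun p : ℝ × ℝ × ℝ => u p.1 * d p.2.1 * nil p.2.2)
      ((volume.restrict (Set.Ico 0 (4 * Real.pi))).prod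
        ((volume.withDensity (fun t : ℝ => ENNReal.ofReal (Real.exp t))).prod volume))

/-- The normalised Haar measure `dk = dθ / 4π` of `K`. -/
def haarK : Measure K :=
  ENNReal.ofReal (1 / (4 * Real.pi)) •
    Measure.map uK (volume.restrict (Set.Ico 0 (4 * Real.pi)))

/-- The Haar measure `dt` of `A`. -/
def haarA : Measure A := Measure.map dA volume

/-- The Haar measure `dξ` of `N`. -/
def haarN : Measure N := Measure.map nilN volume

/-- The generalised Abel transform
`F_f^{<n>}(t) = (ħ exp (t/2) / 4π) ∫₀^{4π} ∫_ℝ f (u_θ d_t n_ξ) exp (-i n θ) dξ dθ`, `n = m / 2`. -/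
def abelTransform (hbar : ℝ) (m : ℤ) (f : SU11 → ℂ) (t : ℝ) : ℂ :=
  ((hbar * Real.exp (t / 2) / (4 * Real.pi) : ℝ) : ℂ) *
    ∫ θ in (0 : ℝ)..(4 * Real.pi), ∫ ξ : ℝ,
      f (u θ * d t * nil ξ) * Complex.exp (-(Complex.I * ((m : ℂ) / 2) * θ))

/-- The spherical Fourier transform of type `χ_n`, `n = m / 2`:
`φ_n^μ(f) = ∫_ℝ F_f^{<n>}(t) exp (t/2) exp (μ (log d_t)) dt`. -/
def sphericalFourier (hbar : ℝ) (m : ℤ) (μ : LieA →ₗ[ℝ] ℂ) (f : SU11 → ℂ) : ℂ :=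
  ∫ t : ℝ, abelTransform hbar m f t * (Real.exp (t / 2) : ℂ) * Complex.exp (μ (logA (dA t)))

/-- A semi-norm on the group: a positive, lower semicontinuous, submultiplicative function that
is bounded on compact sets. -/
structure IsGroupSeminorm (r : SU11 → ℝ) : Prop where
  pos : ∀ x, 0 < r x
  lsc : LowerSemicontinuous r
  mul_le : ∀ x y, r (x * y) ≤ r x * r y
  bdd : ∀ C : Set SU11, IsCompact C → BddAbove (r '' C)

/-- Quasi-bounded functions: those dominated by a multiple of a semi-norm. -/
def QuasiBounded (Φ : SU11 → ℂ) : Prop :=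
  ∃ r : SU11 → ℝ, IsGroupSeminorm r ∧ ∃ C : ℝ, ∀ x, ‖Φ x‖ ≤ C * r x

/-- Convolution on `G`. -/
def conv (f f' : SU11 → ℂ) (x : SU11) : ℂ := ∫ y, f y * f' (y⁻¹ * x) ∂haarG

/-- `Φ(f) = ∫_G f(x) Φ(x⁻¹) dx`. -/
def pairing (Φ f : SU11 → ℂ) : ℂ := ∫ x, f x * Φ x⁻¹ ∂haarG

/-- Spherical functions of type `χ_n`, `n = m / 2`, of height one (values in `End ℂ = ℂ`):
quasi-bounded continuous `K`-central functions `Φ` with `χ_n * Φ = Φ = Φ * χ_n` for which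
`f ↦ ∫ f(x) Φ(x⁻¹) dx` is an irreducible representation on `ℂ` of the convolution algebra
`K_n^♮(G)`, i.e. a nonzero multiplicative functional (linearity is automatic). -/
structure IsSpherical (m : ℤ) (Φ : SU11 → ℂ) : Prop where
  continuous : Continuous Φ
  quasiBounded : QuasiBounded Φ
  central : ∀ (k : K) (x : SU11), Φ ((k : SU11) * x * (k : SU11)⁻¹) = Φ x
  left_type : ∀ x, ∫ k : K, chi m k * Φ ((k : SU11)⁻¹ * x) ∂haarK = Φ x
  right_type : ∀ x, ∫ k : K, Φ (x * (k : SU11)⁻¹) * chi m k ∂haarK = Φ x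
  mul : ∀ f ∈ KNat m, ∀ f' ∈ KNat m, conv f f' ∈ KNat m ∧
    pairing Φ (conv f f') = pairing Φ f * pairing Φ f'
  nonzero : ∃ f ∈ KNat m, pairing Φ f ≠ 0

/-- The Abel transform of type `δ = χ_n`, `n = m / 2`, on `A`:
`F_f^δ(h) = h^ρ ∫_K ∫_N f(k h n) χ_n(k⁻¹) dn dk`. -/
def abelType (m : ℤ) (f : SU11 → ℂ) (h : A) : ℂ :=
  Complex.exp (rho (logA h)) *
    ∫ k : K, ∫ n : N, f ((k : SU11) * (h : SU11) * (n : SU11)) * chi m k⁻¹ ∂haarN ∂haarK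

/-- `T` is a Kangni-type transform of type `χ_n`, `n = m / 2`, with parameter `μ`: on `K_n^♮(G)` it
is a spherical Fourier transformation of type `χ_n`, i.e. it is given by a spherical function of
type `χ_n`, and it has the form `T f = ∫_A F_f^δ(h) h^{μ + ρ} dh`. -/
def IsKangniType (m : ℤ) (μ : LieA →ₗ[ℝ] ℂ) (T : (SU11 → ℂ) → ℂ) : Prop :=
  (∃ Φ : SU11 → ℂ, IsSpherical m Φ ∧ ∀ f ∈ KNat m, T f = pairing Φ f) ∧
  ∀ f ∈ KNat m,
    T f = ∫ h : A, abelType m f h * Complex.exp (μ (logA h) + rho (logA h)) ∂haarA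

end QuasiBoson

end

/-!
# The spherical Fourier transform of type `χ_n` on `SU(1,1)`

Let `rowSum g = α + β`, the first coordinate of `g (1, 1)ᵀ`; for `g = u_θ d_t n_ξ` it equals
`exp (t/2) exp (iθ/2)`, so it carries the `K`- and `A`-components of `g`.

**Haar measure.** `haarG` is visibly invariant under left translation by `K` and under right
translation by `A` and `N`. A Haar measure `ν` of `G` has the same invariance, since `G` is
unimodular: the modular character is trivial on `K` (`K` acts on the compact sets `{|α|² ≤ R}`), on
`A` (which `u_π` inverts), and on `N` (which `A` scales). Under the homeomorphism
`K × AN → G`, `(k, p) ↦ k p⁻¹`, both measures become left-invariant measures of the group `K × AN`,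
and uniqueness of Haar measure there gives `haarG = c • ν` (`haarG_eq_smul_haar`). In particular
`haarG` is bi-invariant.

**The integral formula.** Let `q(z) = (z/|z|)ᵐ |z|^(2c)`, a character of `ℂˣ`, where `μ (t S_x) = c t`
and `n = m / 2`. Fubini's theorem gives `φ(f) = ħ ∫ f w` with `w g = q (conj (rowSum g))`
(`sphericalFourier_eq`). Translating `g` on the right by `u_θ`, using `f (g u_θ) = χ_n(u_θ) f g` and
multiplicativity of `q`, replaces `w g` by `q (ᾱ + β̄ ζ)`, `ζ = exp (iθ)`; then average over `θ`. The
average depends on `β` only through `|β|`, so `β̄` may be replaced by `-β`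
(`integral_mul_circleAvg_eq_weight`).

**The spherical function.** Hence `φ(f) = ∫ f(x) Φ(x⁻¹) dx` for `ħ = 1`, where `Φ x` is the average of
`q (α + β ζ)`. The same averaging, with left translations, gives the product formula
`∫ f(x) w(y x) dx = Φ(y⁻¹) ∫ f w` (`integral_mul_weight_mul`), and with Fubini's theorem the functional is
multiplicative on convolutions. `Φ` is dominated by a power of `|α| + |β|`, which is submultiplicative,
and the functional does not vanish on a cut-off of `x ↦ conj (Φ x⁻¹)`.
-/

noncomputable section

namespace QuasiBoson

/-! ### Matrix entries and the topology of `SU(1,1)` -/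

/-- The defining relations `gᴴ σ_z g = σ_z` and `det g = 1` determine the second row of `g` by
the first. -/
theorem mat_eq (g : SU11) : mat g = !![alpha g, beta g; star (beta g), star (alpha g)] := by
  have hdet : mat g 0 0 * mat g 1 1 - mat g 0 1 * mat g 1 0 = 1 := by
    rw [← det_fin_two]; exact (g : SpecialLinearGroup (Fin 2) ℂ).2
  have hg : (mat g)ᴴ * sigmaZ * mat g = sigmaZ := g.2
  have h00 := congrFun (congrFun hg 0) 0
  have h01 := congrFun (congrFun hg 0) 1
  have h10 := congrFun (congrFun hg 1) 0
  have h11 := congrFun (congrFun hg 1) 1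
  simp [sigmaZ, Matrix.mul_apply, Fin.sum_univ_two] at h00 h01 h10 h11
  have hd : mat g 1 1 = star (alpha g) := by
    simp only [alpha, Complex.star_def]
    linear_combination (-mat g 1 1) * h00 + (starRingEnd ℂ) (mat g 0 0) * hdet
      + mat g 1 0 * h01
  have hc : mat g 1 0 = star (beta g) := by
    simp only [beta, Complex.star_def]
    linear_combination mat g 1 0 * h11 + (starRingEnd ℂ) (mat g 0 1) * hdet
      - mat g 1 1 * h10
  rw [← hd, ← hc]
  exact eta_fin_two (mat g)

theorem alpha_mul_star_sub (g : SU11) :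
    alpha g * star (alpha g) - beta g * star (beta g) = 1 := by
  have h : (mat g).det = 1 := (g : SpecialLinearGroup (Fin 2) ℂ).2
  rwa [mat_eq, det_fin_two_of] at h

theorem norm_alpha_sq (g : SU11) : ‖alpha g‖ ^ 2 = 1 + ‖beta g‖ ^ 2 := by
  have h := alpha_mul_star_sub g
  simp only [Complex.star_def, Complex.mul_conj, Complex.normSq_eq_norm_sq] at h
  have h' : ‖alpha g‖ ^ 2 - ‖beta g‖ ^ 2 = 1 := by exact_mod_cast h
  linarith

theorem norm_beta_lt (g : SU11) : ‖beta g‖ < ‖alpha g‖ := by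
  have := norm_alpha_sq g
  nlinarith [norm_nonneg (alpha g), norm_nonneg (beta g)]

theorem ext_alpha_beta {g g' : SU11} (ha : alpha g = alpha g') (hb : beta g = beta g') :
    g = g' := ext_mat (by rw [mat_eq, mat_eq, ha, hb])

@[simp] theorem alpha_mk (a b : ℂ) (h) : alpha (mk a b h) = a := rfl
@[simp] theorem beta_mk (a b : ℂ) (h) : beta (mk a b h) = b := rfl

theorem alpha_mul (g g' : SU11) :
    alpha (g * g') = alpha g * alpha g' + beta g * star (beta g') := by
  rw [alpha, mat_mul, mat_eq g, mat_eq g']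
  simp [Matrix.mul_apply, Fin.sum_univ_two]

theorem beta_mul (g g' : SU11) :
    beta (g * g') = alpha g * beta g' + beta g * star (alpha g') := by
  rw [beta, mat_mul, mat_eq g, mat_eq g']
  simp [Matrix.mul_apply, Fin.sum_univ_two]

@[simp] theorem alpha_one : alpha 1 = 1 := by
  change (1 : Matrix (Fin 2) (Fin 2) ℂ) 0 0 = 1; simp

@[simp] theorem beta_one : beta 1 = 0 := by
  change (1 : Matrix (Fin 2) (Fin 2) ℂ) 0 1 = 0; simp

theorem inv_eq_mk (g : SU11) : g⁻¹ = mk (star (alpha g)) (-beta g) (by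
    rw [star_star, star_neg, neg_mul_neg, mul_comm]; exact alpha_mul_star_sub g) := by
  rw [inv_eq_iff_mul_eq_one]
  apply ext_alpha_beta
  · rw [alpha_mul, alpha_mk, beta_mk, alpha_one, star_neg, mul_neg, ← sub_eq_add_neg]
    exact alpha_mul_star_sub g
  · rw [beta_mul, alpha_mk, beta_mk, beta_one, star_star]; ring

@[simp] theorem alpha_inv (g : SU11) : alpha g⁻¹ = star (alpha g) := by rw [inv_eq_mk, alpha_mk]
@[simp] theorem beta_inv (g : SU11) : beta g⁻¹ = -beta g := by rw [inv_eq_mk, beta_mk]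

theorem isEmbedding_mat : Topology.IsEmbedding mat :=
  (Topology.IsEmbedding.subtypeVal (p := fun M : Matrix (Fin 2) (Fin 2) ℂ => M.det = 1)).comp
    (Topology.IsEmbedding.subtypeVal (p := fun g => g ∈ SU11))

@[fun_prop] theorem continuous_alpha : Continuous alpha :=
  isEmbedding_mat.continuous.matrix_elem 0 0

@[fun_prop] theorem continuous_beta : Continuous beta :=
  isEmbedding_mat.continuous.matrix_elem 0 1

/-- `SU(1,1)` is the hyperboloid `|α|² - |β|² = 1` in `ℂ²`. -/
theorem isClosedEmbedding_alpha_beta :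
    Topology.IsClosedEmbedding (fun g : SU11 => (alpha g, beta g)) := by
  have hc : Continuous (fun g : SU11 => (alpha g, beta g)) := by fun_prop
  refine ⟨⟨Topology.IsInducing.of_comp (g := fun p : ℂ × ℂ =>
    !![p.1, p.2; star p.2, star p.1]) hc ?_ ?_, ?_⟩, ?_⟩
  · apply continuous_matrix
    intro i j
    fin_cases i <;> fin_cases j <;> simp <;> fun_prop
  · have : (fun p : ℂ × ℂ => !![p.1, p.2; star p.2, star p.1]) ∘
        (fun g : SU11 => (alpha g, beta g)) = mat := by
      funext g; exact (mat_eq g).symm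
    rw [this]
    exact isEmbedding_mat.isInducing
  · intro g g' h
    exact ext_alpha_beta (congrArg Prod.fst h) (congrArg Prod.snd h)
  · have : Set.range (fun g : SU11 => (alpha g, beta g)) =
        {p : ℂ × ℂ | p.1 * star p.1 - p.2 * star p.2 = 1} := by
      ext p
      constructor
      · rintro ⟨g, rfl⟩
        exact alpha_mul_star_sub g
      · intro h
        exact ⟨mk p.1 p.2 h, rfl⟩
    rw [this]
    exact isClosed_eq (by fun_prop) continuous_const

theorem continuous_iff_alpha_beta {X : Type*} [TopologicalSpace X] {f : X → SU11} :
    Continuous f ↔ Continuous (fun x => alpha (f x)) ∧ Continuous (fun x => beta (f x)) := by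
  rw [isClosedEmbedding_alpha_beta.isInducing.continuous_iff]
  exact continuous_prodMk

instance : LocallyCompactSpace SU11 := isClosedEmbedding_alpha_beta.locallyCompactSpace

instance : SecondCountableTopology SU11 :=
  isClosedEmbedding_alpha_beta.isInducing.secondCountableTopology

/-! ### The one-parameter subgroups and the Iwasawa coordinates -/

@[simp] theorem alpha_u (θ : ℝ) : alpha (u θ) = Complex.exp (Complex.I * (θ / 2 : ℝ)) :=
  alpha_mk _ _ _
@[simp] theorem beta_u (θ : ℝ) : beta (u θ) = 0 :=
  beta_mk _ _ _
@[simp] theorem alpha_d (t : ℝ) : alpha (d t) = Real.cosh (t / 2) :=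
  alpha_mk _ _ _
@[simp] theorem beta_d (t : ℝ) : beta (d t) = Real.sinh (t / 2) :=
  beta_mk _ _ _
@[simp] theorem alpha_nil (ξ : ℝ) : alpha (nil ξ) = 1 + Complex.I * (ξ / 2 : ℝ) :=
  alpha_mk _ _ _
@[simp] theorem beta_nil (ξ : ℝ) : beta (nil ξ) = -(Complex.I * (ξ / 2 : ℝ)) :=
  beta_mk _ _ _

@[fun_prop] theorem continuous_u : Continuous u :=
  continuous_iff_alpha_beta.2 ⟨by simp only [alpha_u]; fun_prop, by simp only [beta_u]; fun_prop⟩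

@[fun_prop] theorem continuous_d : Continuous d :=
  continuous_iff_alpha_beta.2 ⟨by simp only [alpha_d]; fun_prop, by simp only [beta_d]; fun_prop⟩

@[fun_prop] theorem continuous_nil : Continuous nil :=
  continuous_iff_alpha_beta.2
    ⟨by simp only [alpha_nil]; fun_prop, by simp only [beta_nil]; fun_prop⟩

theorem d_zero : d 0 = 1 := ext_alpha_beta (by simp) (by simp)
theorem nil_zero : nil 0 = 1 := ext_alpha_beta (by simp) (by simp)

theorem u_periodic : Function.Periodic u (4 * Real.pi) := by
  intro θ
  refine ext_alpha_beta ?_ (by rw [beta_u, beta_u])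
  rw [alpha_u, alpha_u, show Complex.I * ((θ + 4 * Real.pi) / 2 : ℝ) =
    Complex.I * (θ / 2 : ℝ) + 2 * Real.pi * Complex.I by push_cast; ring, Complex.exp_add,
    Complex.exp_two_pi_mul_I, mul_one]

theorem u_zero : u 0 = 1 := ext_alpha_beta (by simp) (by simp)

theorem norm_alpha_u (θ : ℝ) : ‖alpha (u θ)‖ = 1 := by
  rw [alpha_u, mul_comm, Complex.norm_exp_ofReal_mul_I]

theorem exists_u_eq {z : ℂ} (hz : ‖z‖ = 1) : ∃ θ, alpha (u θ) = z := by
  refine ⟨2 * z.arg, ?_⟩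
  rw [alpha_u, mul_div_cancel_left₀ _ (two_ne_zero' ℝ), mul_comm]
  have := Complex.norm_mul_exp_arg_mul_I z
  rwa [hz, Complex.ofReal_one, one_mul] at this

theorem mem_K_iff {g : SU11} : g ∈ K ↔ beta g = 0 := by
  constructor
  · rintro ⟨θ, rfl⟩; exact beta_u _
  · intro h
    have h1 : ‖alpha g‖ = 1 := by
      have := norm_alpha_sq g
      rw [h] at this
      have h0 := norm_nonneg (alpha g)
      simp only [norm_zero] at this
      nlinarith
    obtain ⟨θ, hθ⟩ := exists_u_eq h1
    rw [← ext_alpha_beta hθ (by rw [h, beta_u])]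
    exact mem_oneParam u u_add θ

theorem exists_uK_eq (k : K) : ∃ θ, k = uK θ := by
  obtain ⟨k, ⟨θ, rfl⟩⟩ := k
  exact ⟨θ.toAdd, rfl⟩

/-- The sum of the first row of `g`, that is, the first coordinate of `g (1, 1)ᵀ`. As
`u_θ d_t n_ξ (1, 1)ᵀ = exp (t/2) (exp (iθ/2), exp (-iθ/2))ᵀ`, it encodes the `K`- and
`A`-components of `g`. -/
def rowSum (g : SU11) : ℂ := alpha g + beta g

theorem rowSum_ne_zero (g : SU11) : rowSum g ≠ 0 := by
  intro h
  have h1 : alpha g = -beta g := eq_neg_of_add_eq_zero_left h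
  have := norm_beta_lt g
  rw [h1, norm_neg] at this
  exact lt_irrefl _ this

@[fun_prop] theorem continuous_rowSum : Continuous rowSum := by unfold rowSum; fun_prop

theorem rowSum_mul (g g' : SU11) :
    rowSum (g * g') = alpha g * rowSum g' + beta g * star (rowSum g') := by
  simp only [rowSum, alpha_mul, beta_mul, star_add]; ring

theorem rowSum_mul_of_real (g : SU11) {g' : SU11} (h : star (rowSum g') = rowSum g') :
    rowSum (g * g') = rowSum g * rowSum g' := by
  rw [rowSum_mul, h, ← add_mul]; rfl

@[simp] theorem rowSum_d (t : ℝ) : rowSum (d t) = Real.exp (t / 2) := by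
  rw [rowSum, alpha_d, beta_d, ← Real.cosh_add_sinh]; push_cast; rfl

@[simp] theorem rowSum_nil (ξ : ℝ) : rowSum (nil ξ) = 1 := by
  rw [rowSum, alpha_nil, beta_nil]; ring

theorem rowSum_d_mul_nil (t ξ : ℝ) : rowSum (d t * nil ξ) = Real.exp (t / 2) := by
  rw [rowSum_mul_of_real _ (by simp), rowSum_d, rowSum_nil, mul_one]

theorem rowSum_iwasawa (θ t ξ : ℝ) :
    rowSum (u θ * d t * nil ξ) = Real.exp (t / 2) * alpha (u θ) := by
  rw [mul_assoc, rowSum_mul, rowSum_d_mul_nil, beta_u]; ring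

/-- The `A`-coordinate `t` of `g = u_θ d_t n_ξ`. -/
def coordA (g : SU11) : ℝ := 2 * Real.log ‖rowSum g‖

/-- The `K`-component `u_θ` of `g = u_θ d_t n_ξ`. -/
def compK (g : SU11) : SU11 := mk (rowSum g / ‖rowSum g‖) 0 (by
  have h : (‖rowSum g‖ : ℂ) ≠ 0 := by simpa using rowSum_ne_zero g
  rw [star_zero, mul_zero, sub_zero, Complex.star_def, Complex.mul_conj', norm_div,
    Complex.norm_real, norm_norm, div_self (by simpa using rowSum_ne_zero g)]
  simp)

/-- The `N`-coordinate `ξ` of `g = u_θ d_t n_ξ`. -/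
def coordN (g : SU11) : ℝ := 2 * (alpha (d (-coordA g) * ((compK g)⁻¹ * g))).im

@[fun_prop] theorem continuous_coordA : Continuous coordA := by
  unfold coordA
  exact continuous_const.mul
    (continuous_rowSum.norm.log fun g => norm_ne_zero_iff.2 (rowSum_ne_zero g))

@[fun_prop] theorem continuous_compK : Continuous compK := by
  refine continuous_iff_alpha_beta.2 ⟨?_, by simp only [compK, beta_mk]; fun_prop⟩
  simp only [compK, alpha_mk]
  exact continuous_rowSum.div (by fun_prop) fun g => by simpa using rowSum_ne_zero g

@[fun_prop] theorem continuous_coordN : Continuous coordN := by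
  unfold coordN
  fun_prop

theorem compK_mem (g : SU11) : compK g ∈ K := mem_K_iff.2 rfl

theorem compK_mul_of_pos {k p : SU11} (hk : k ∈ K) (hp : rowSum p = ‖rowSum p‖) :
    compK (k * p) = k := by
  rw [mem_K_iff] at hk
  have hk1 : ‖alpha k‖ = 1 := by
    have := norm_alpha_sq k
    rw [hk, norm_zero] at this
    nlinarith [norm_nonneg (alpha k)]
  have hp0 : (‖rowSum p‖ : ℂ) ≠ 0 := by simpa using rowSum_ne_zero p
  refine ext_alpha_beta ?_ hk.symm
  rw [compK, alpha_mk, rowSum_mul, hk, zero_mul, add_zero, norm_mul, hk1, one_mul, hp]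
  simp only [Complex.norm_real, norm_norm]
  field_simp

theorem coordA_iwasawa (θ t ξ : ℝ) : coordA (u θ * d t * nil ξ) = t := by
  rw [coordA, rowSum_iwasawa, norm_mul, norm_alpha_u, mul_one, Complex.norm_real,
    Real.norm_of_nonneg (Real.exp_pos _).le, Real.log_exp]
  ring

theorem compK_iwasawa (θ t ξ : ℝ) : compK (u θ * d t * nil ξ) = u θ := by
  rw [mul_assoc]
  refine compK_mul_of_pos (mem_oneParam u u_add θ) ?_
  rw [rowSum_d_mul_nil, Complex.norm_real, Real.norm_of_nonneg (Real.exp_pos _).le]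

theorem d_neg (t : ℝ) : d (-t) = (d t)⁻¹ := by
  rw [eq_inv_iff_mul_eq_one, ← d_add, neg_add_cancel, d_zero]

theorem coordN_iwasawa (θ t ξ : ℝ) : coordN (u θ * d t * nil ξ) = ξ := by
  rw [coordN, coordA_iwasawa, compK_iwasawa, d_neg]
  rw [show (d t)⁻¹ * ((u θ)⁻¹ * (u θ * d t * nil ξ)) = nil ξ by group, alpha_nil]
  simp only [Complex.add_im, Complex.one_im, Complex.I_mul_im, Complex.ofReal_re]
  ring

/-- An element fixing the vector `(1, 1)ᵀ` belongs to `N`. -/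
theorem eq_nil_of_rowSum_eq_one {g : SU11} (h : rowSum g = 1) : g = nil (2 * (alpha g).im) := by
  have hb : beta g = 1 - alpha g := by rw [← h, rowSum]; ring
  have hre : (alpha g).re = 1 := by
    have := alpha_mul_star_sub g
    rw [hb] at this
    have := congrArg Complex.re this
    simp at this
    linarith
  have ha : alpha g = 1 + Complex.I * ((2 * (alpha g).im) / 2 : ℝ) := by
    apply Complex.ext <;> simp [hre]
  refine ext_alpha_beta ha ?_
  rw [beta_nil, hb]
  linear_combination -ha

/-- The Iwasawa decomposition `G = KAN`. -/
theorem iwasawa (g : SU11) : compK g * d (coordA g) * nil (coordN g) = g := by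
  have h0 := rowSum_ne_zero g
  have hn : ‖rowSum g‖ ≠ 0 := norm_ne_zero_iff.2 h0
  have h1 : rowSum ((compK g)⁻¹ * g) = ‖rowSum g‖ := by
    rw [rowSum_mul, alpha_inv, beta_inv, compK, alpha_mk, beta_mk, neg_zero, zero_mul, add_zero,
      Complex.star_def, map_div₀, Complex.conj_ofReal, div_mul_eq_mul_div, Complex.conj_mul',
      sq, mul_div_assoc, div_self (by exact_mod_cast hn), mul_one]
  have h2 : rowSum (d (-coordA g) * ((compK g)⁻¹ * g)) = 1 := by
    rw [rowSum_mul_of_real _ (by rw [h1, Complex.star_def, Complex.conj_ofReal]), h1, rowSum_d,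
      coordA, neg_div, mul_div_cancel_left₀ _ (two_ne_zero' ℝ), Real.exp_neg,
      Real.exp_log (by positivity)]
    push_cast
    exact inv_mul_cancel₀ (by exact_mod_cast hn)
  rw [coordN, ← eq_nil_of_rowSum_eq_one h2, d_neg]
  group

/-- `A` normalizes `N`, acting by dilations. -/
theorem nil_mul_d (ξ s : ℝ) : nil ξ * d s = d s * nil (Real.exp (-s) * ξ) := by
  have h : rowSum (d (-s) * (nil ξ * d s)) = 1 := by
    rw [rowSum_mul_of_real, rowSum_mul_of_real, rowSum_d, rowSum_d, rowSum_nil, one_mul,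
      ← Complex.ofReal_mul, ← Real.exp_add]
    · simp [neg_div]
    · simp [-Complex.ofReal_exp, Complex.conj_ofReal]
    · rw [rowSum_mul_of_real] <;> simp [-Complex.ofReal_exp, Complex.conj_ofReal]
  have := eq_nil_of_rowSum_eq_one h
  have him : 2 * (alpha (d (-s) * (nil ξ * d s))).im = Real.exp (-s) * ξ := by
    rw [show Real.exp (-s) = Real.exp (-(s / 2)) * Real.exp (-(s / 2)) by
      rw [← Real.exp_add]; ring_nf, ← Real.cosh_sub_sinh]
    simp only [alpha_mul, beta_mul, alpha_d, beta_d, alpha_nil, beta_nil, neg_div, Real.cosh_neg,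
      Real.sinh_neg, Complex.star_def, map_add, map_mul, map_neg, Complex.conj_ofReal, map_one,
      Complex.conj_I, Complex.add_im, Complex.mul_im, Complex.add_re, Complex.mul_re,
      Complex.neg_im, Complex.neg_re, Complex.ofReal_re, Complex.ofReal_im, Complex.I_re,
      Complex.I_im, Complex.one_re, Complex.one_im]
    ring
  rw [him, d_neg] at this
  rw [← this]; group

/-! ### Invariance of the measure `haarG` under `K` and `AN` -/

theorem continuous_iwasawa :
    Continuous (fun p : ℝ × ℝ × ℝ => u p.1 * d p.2.1 * nil p.2.2) := by fun_prop

theorem lintegral_prod_withDensity {f : ℝ → ℝ} (hf : Measurable f) {F : ℝ × ℝ × ℝ → ENNReal}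
    (hF : Measurable F) (s : Set ℝ) :
    ∫⁻ p, F p ∂((volume.restrict s).prod
      ((volume.withDensity fun t => ENNReal.ofReal (f t)).prod volume)) =
      ∫⁻ θ in s, ∫⁻ t, ENNReal.ofReal (f t) * ∫⁻ ξ, F (θ, t, ξ) := by
  rw [lintegral_prod _ hF.aemeasurable]
  refine lintegral_congr fun θ => ?_
  have hF' : Measurable (fun p : ℝ × ℝ => F (θ, p)) := hF.comp measurable_prodMk_left
  rw [lintegral_prod _ hF'.aemeasurable, lintegral_withDensity_eq_lintegral_mul _
    hf.ennreal_ofReal hF'.lintegral_prod_right']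
  rfl

theorem lintegral_haarG {F : SU11 → ENNReal} (hF : Measurable F) :
    ∫⁻ g, F g ∂haarG = ENNReal.ofReal (1 / (4 * Real.pi)) *
      ∫⁻ θ in Set.Ico 0 (4 * Real.pi), ∫⁻ t, ENNReal.ofReal (Real.exp t) *
        ∫⁻ ξ, F (u θ * d t * nil ξ) := by
  rw [haarG, lintegral_smul_measure, smul_eq_mul, lintegral_map hF continuous_iwasawa.measurable]
  congr 1
  exact lintegral_prod_withDensity Real.measurable_exp (hF.comp continuous_iwasawa.measurable) _

theorem map_mul_right_nil (η : ℝ) : haarG.map (· * nil η) = haarG := by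
  refine Measure.ext_of_lintegral _ fun F hF => ?_
  rw [lintegral_map hF (measurable_mul_const _), lintegral_haarG hF,
    lintegral_haarG (F := fun g => F (g * nil η)) (hF.comp (measurable_mul_const _))]
  simp_rw [mul_assoc _ (nil _) (nil η), ← nil_add]
  congr 1
  refine lintegral_congr fun θ => lintegral_congr fun t => ?_
  rw [lintegral_add_right_eq_self (fun ξ => F (u θ * d t * nil ξ))]

theorem lintegral_comp_mul_left {a : ℝ} (ha : 0 < a) {F : ℝ → ENNReal} (hF : Measurable F) :
    ∫⁻ x, F x = ENNReal.ofReal a * ∫⁻ x, F (a * x) := by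
  conv_lhs => rw [← Real.smul_map_volume_mul_left ha.ne', abs_of_pos ha]
  rw [lintegral_smul_measure, smul_eq_mul, lintegral_map hF (measurable_const_mul a)]

/-- Moving `d_s` past `n_ξ` scales `dξ` by `exp s`, which the density `exp t` of the `A`-coordinate
compensates. -/
theorem map_mul_right_d (s : ℝ) : haarG.map (· * d s) = haarG := by
  refine Measure.ext_of_lintegral _ fun F hF => ?_
  rw [lintegral_map hF (measurable_mul_const _), lintegral_haarG hF,
    lintegral_haarG (F := fun g => F (g * d s)) (hF.comp (measurable_mul_const _))]
  congr 1
  refine lintegral_congr fun θ => ?_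
  simp_rw [mul_assoc _ (nil _) (d s), nil_mul_d, ← mul_assoc, mul_assoc _ (d _) (d s), ← d_add]
  rw [← lintegral_add_right_eq_self
    (fun t => ENNReal.ofReal (Real.exp t) * ∫⁻ ξ, F (u θ * d t * nil ξ)) s]
  refine lintegral_congr fun t => ?_
  rw [lintegral_comp_mul_left (Real.exp_pos (-s)) (F := fun ξ => F (u θ * d (t + s) * nil ξ))
    (hF.comp (by fun_prop)), ← mul_assoc, ← ENNReal.ofReal_mul (Real.exp_pos _).le,
    ← Real.exp_add, add_neg_cancel_right]

theorem lintegral_Ico_add_right {F : ℝ → ENNReal} {T : ℝ} (hT : 0 < T)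
    (hF : Function.Periodic F T) (φ : ℝ) :
    ∫⁻ θ in Set.Ico 0 T, F (φ + θ) = ∫⁻ θ in Set.Ico 0 T, F θ := by
  have : Fact (0 < T) := ⟨hT⟩
  have h1 := AddCircle.lintegral_preimage T 0 hF.lift
  have h2 := AddCircle.lintegral_preimage T 0 (fun b => hF.lift ((φ : AddCircle T) + b))
  rw [lintegral_add_left_eq_self, ← h1] at h2
  simpa only [← AddCircle.coe_add, Function.Periodic.lift_coe, zero_add,
    restrict_Ico_eq_restrict_Ioc] using h2

theorem map_mul_left_u (φ : ℝ) : haarG.map (u φ * ·) = haarG := by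
  refine Measure.ext_of_lintegral _ fun F hF => ?_
  rw [lintegral_map hF (measurable_const_mul _), lintegral_haarG hF,
    lintegral_haarG (F := fun g => F (u φ * g)) (hF.comp (measurable_const_mul _))]
  simp_rw [← mul_assoc, ← u_add]
  congr 1
  refine lintegral_Ico_add_right (F := fun θ => ∫⁻ t, ENNReal.ofReal (Real.exp t) *
    ∫⁻ ξ, F (u θ * d t * nil ξ)) (by positivity) (fun θ => ?_) φ
  simp only [u_periodic θ]

theorem haarG_lt_top {C : Set SU11} (hC : IsCompact C) : haarG C < ⊤ := by
  have : IsLocallyFiniteMeasure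
      (volume.withDensity (fun t : ℝ => ENNReal.ofReal (Real.exp t))) :=
    IsLocallyFiniteMeasure.withDensity_ofReal Real.continuous_exp
  rw [haarG, Measure.smul_apply, smul_eq_mul,
    Measure.map_apply continuous_iwasawa.measurable hC.measurableSet]
  refine ENNReal.mul_lt_top ENNReal.ofReal_lt_top ?_
  have hsub : (fun p : ℝ × ℝ × ℝ => u p.1 * d p.2.1 * nil p.2.2) ⁻¹' C ⊆
      Set.univ ×ˢ ((coordA '' C) ×ˢ (coordN '' C)) := fun p hp =>
    ⟨trivial, ⟨_, hp, coordA_iwasawa _ _ _⟩, ⟨_, hp, coordN_iwasawa _ _ _⟩⟩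
  refine (measure_mono hsub).trans_lt ?_
  rw [Measure.prod_prod, Measure.prod_prod]
  refine ENNReal.mul_lt_top ?_ (ENNReal.mul_lt_top ?_ ?_)
  · rw [Measure.restrict_apply_univ, Real.volume_Ico]
    exact ENNReal.ofReal_lt_top
  · exact (hC.image continuous_coordA).measure_lt_top
  · exact (hC.image continuous_coordN).measure_lt_top

instance : IsFiniteMeasureOnCompacts haarG := ⟨fun _ hC => haarG_lt_top hC⟩

theorem haarG_ne_zero : haarG ≠ 0 := by
  intro h
  have h1 : haarG Set.univ = 0 := by rw [h]; simp
  rw [haarG, Measure.smul_apply, smul_eq_mul, Measure.map_apply continuous_iwasawa.measurable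
    MeasurableSet.univ, Set.preimage_univ, mul_eq_zero, Measure.measure_univ_eq_zero] at h1
  rcases h1 with h1 | h1
  · rw [ENNReal.ofReal_eq_zero] at h1
    exact absurd h1 (not_le.2 (by positivity))
  · have h2 := congrArg (fun ν => ν (Set.univ ×ˢ (Set.univ ×ˢ Set.univ))) h1
    simp only [Measure.prod_prod, Measure.coe_zero, Pi.zero_apply, mul_eq_zero,
      Measure.restrict_apply_univ, Real.volume_Ico, Real.volume_univ, ENNReal.top_ne_zero,
      or_false, ENNReal.ofReal_eq_zero, Measure.measure_univ_eq_zero] at h2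
    rcases h2 with h2 | h2
    · exact absurd h2 (not_le.2 (by have := Real.pi_pos; linarith))
    · rw [withDensity_eq_zero_iff (by fun_prop)] at h2
      obtain ⟨x, hx⟩ := h2.exists
      exact absurd (ENNReal.ofReal_eq_zero.1 hx) (not_le.2 (Real.exp_pos x))

/-! ### Unimodularity -/

/-- The sets `{|α|² ≤ R}` form a `K`-bi-invariant compact exhaustion of `G`. -/
theorem isCompact_norm_alpha_sq_le (R : ℝ) : IsCompact {g : SU11 | ‖alpha g‖ ^ 2 ≤ R} := by
  have h1 : IsCompact ((Metric.closedBall (0 : ℂ) (max R 1)) ×ˢ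
      (Metric.closedBall (0 : ℂ) (max R 1))) :=
    (isCompact_closedBall _ _).prod (isCompact_closedBall _ _)
  refine (isClosedEmbedding_alpha_beta.isCompact_preimage h1).of_isClosed_subset
    (isClosed_le (by fun_prop) continuous_const) fun g hg => ?_
  have hg' : ‖alpha g‖ ^ 2 ≤ R := hg
  have hb := norm_beta_lt g
  have ha := norm_alpha_sq g
  have h0 := norm_nonneg (beta g)
  have h2 : ‖alpha g‖ ≤ max R 1 := le_max_of_le_left (by nlinarith)
  simp only [Set.mem_preimage, Set.mem_prod, mem_closedBall_zero_iff]
  exact ⟨h2, hb.le.trans h2⟩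

theorem norm_alpha_mul_u (g : SU11) (θ : ℝ) : ‖alpha (g * u θ)‖ = ‖alpha g‖ := by
  rw [alpha_mul, beta_u, star_zero, mul_zero, add_zero, norm_mul, norm_alpha_u, mul_one]

theorem norm_alpha_u_mul (g : SU11) (θ : ℝ) : ‖alpha (u θ * g)‖ = ‖alpha g‖ := by
  rw [alpha_mul, beta_u, zero_mul, add_zero, norm_mul, norm_alpha_u, one_mul]

/-- A right translation by `u_θ` maps the compact set `{|α|² ≤ 2}`, a neighbourhood of `1`, to
itself, hence cannot rescale Haar measure. -/
theorem modularCharacter_u (θ : ℝ) : Measure.modularCharacter (u θ) = 1 := by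
  have h := Measure.map_right_mul_eq_modularCharacterFun_smul (Measure.haar (G := SU11)) (u θ)
  set C := {g : SU11 | ‖alpha g‖ ^ 2 ≤ 2} with hC
  have hcomp : IsCompact C := isCompact_norm_alpha_sq_le 2
  have h1 := congrArg (fun ν => ν C) h
  simp only [Measure.map_apply (measurable_mul_const (u θ)) hcomp.measurableSet] at h1
  have h2 : (fun g => g * u θ) ⁻¹' C = C := by
    ext g; simp only [hC, Set.mem_preimage, Set.mem_ofPred_eq, norm_alpha_mul_u]
  rw [h2] at h1
  have h3 : Measure.haar C ≠ 0 := by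
    refine (Measure.measure_pos_of_mem_nhds Measure.haar (x := 1) ?_).ne'
    refine Filter.mem_of_superset ((isOpen_lt (f := fun g : SU11 => ‖alpha g‖ ^ 2)
      (g := fun _ => (2 : ℝ)) (by fun_prop) continuous_const).mem_nhds ?_) ?_
    · simp
    · intro g hg
      rw [Set.mem_ofPred_eq] at hg
      exact hg.le
  have h4 : Measure.haar C ≠ ⊤ := hcomp.measure_lt_top.ne
  have h5 : (Measure.modularCharacterFun (u θ) : ENNReal) = 1 := by
    have h6 : (Measure.modularCharacterFun (u θ) : ENNReal) * Measure.haar C =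
      1 * Measure.haar C := by rw [one_mul]; exact h1.symm
    exact (ENNReal.mul_left_inj h3 h4).1 h6
  exact_mod_cast h5

/-- The Weyl group element `u_π` inverts `A`. -/
theorem u_pi_mul_d (t : ℝ) : u Real.pi * d t = (d t)⁻¹ * u Real.pi := by
  have h : Complex.exp (Complex.I * (Real.pi / 2 : ℝ)) = Complex.I := by
    rw [mul_comm, Complex.ofReal_div, Complex.ofReal_ofNat, Complex.exp_pi_div_two_mul_I]
  apply ext_alpha_beta
  · rw [alpha_mul, alpha_mul]
    simp [-Complex.ofReal_cosh, -Complex.ofReal_sinh, Complex.conj_ofReal, mul_comm]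
  · rw [beta_mul, beta_mul, alpha_u, h]
    simp only [beta_d, beta_u, zero_mul, add_zero, alpha_inv, mul_zero, beta_inv, zero_add]
    simp [mul_comm]

theorem modularCharacter_d (t : ℝ) : Measure.modularCharacter (d t) = 1 := by
  have h := congrArg Measure.modularCharacter (u_pi_mul_d t)
  rw [map_mul, map_mul, modularCharacter_u, one_mul, mul_one, ← d_neg] at h
  have h1 := congrArg Measure.modularCharacter (inv_mul_cancel (d t))
  rw [← d_neg, map_mul, map_one, ← h, ← sq] at h1
  exact (pow_eq_one_iff_of_nonneg zero_le two_ne_zero).1 h1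

/-- Conjugation by `d_{- log 2}` turns `n_ξ` into its square. -/
theorem modularCharacter_nil (ξ : ℝ) : Measure.modularCharacter (nil ξ) = 1 := by
  have h := congrArg Measure.modularCharacter (nil_mul_d ξ (-Real.log 2))
  rw [map_mul, map_mul, modularCharacter_d, one_mul, mul_one, neg_neg,
    Real.exp_log two_pos, two_mul, nil_add, map_mul] at h
  have h0 : Measure.modularCharacter (nil ξ) ≠ 0 := (Measure.modularCharacterFun_pos _).ne'
  exact (mul_eq_left₀ h0).1 h.symm

theorem exists_iwasawa (g : SU11) : ∃ θ t ξ, g = u θ * d t * nil ξ := by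
  obtain ⟨θ, hθ⟩ := exists_uK_eq ⟨compK g, compK_mem g⟩
  refine ⟨θ, coordA g, coordN g, ?_⟩
  rw [← show compK g = u θ from congrArg Subtype.val hθ, iwasawa]

theorem modularCharacter_eq_one (g : SU11) : Measure.modularCharacter g = 1 := by
  obtain ⟨θ, t, ξ, rfl⟩ := exists_iwasawa g
  rw [map_mul, map_mul, modularCharacter_u, modularCharacter_d, modularCharacter_nil]
  simp

theorem haar_isMulRightInvariant : (Measure.haar (G := SU11)).IsMulRightInvariant := by
  refine ⟨fun g => ?_⟩
  rw [Measure.map_right_mul_eq_modularCharacterFun_smul]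
  change Measure.modularCharacter g • _ = _
  rw [modularCharacter_eq_one, one_smul]

/-! ### The measure `haarG` is a Haar measure -/

instance (H : Subgroup SU11) : SecondCountableTopology H :=
  TopologicalSpace.Subtype.secondCountableTopology _

/-- The group `AN`, the stabilizer of the ray through `(1, 1)ᵀ`. -/
def AN : Subgroup SU11 where
  carrier := {g | rowSum g = ‖rowSum g‖}
  one_mem' := by simp [rowSum]
  mul_mem' := by
    intro a b ha hb
    change rowSum (a * b) = ‖rowSum (a * b)‖
    rw [rowSum_mul_of_real, norm_mul, Complex.ofReal_mul, ← (ha : rowSum a = _),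
      ← (hb : rowSum b = _)]
    rw [(hb : rowSum b = _), Complex.star_def, Complex.conj_ofReal]
  inv_mem' := by
    intro a ha
    change rowSum a⁻¹ = ‖rowSum a⁻¹‖
    have ha' : rowSum a = ‖rowSum a‖ := ha
    have h : rowSum (a⁻¹ * a) = rowSum a⁻¹ * rowSum a :=
      rowSum_mul_of_real _ (by rw [ha', Complex.star_def, Complex.conj_ofReal])
    rw [inv_mul_cancel, rowSum, alpha_one, beta_one, add_zero] at h
    rw [eq_inv_of_mul_eq_one_left h.symm, norm_inv, Complex.ofReal_inv, ← ha']

theorem mem_AN_iff {g : SU11} : g ∈ AN ↔ rowSum g = ‖rowSum g‖ := Iff.rfl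

theorem eq_of_mem_AN {g : SU11} (hg : g ∈ AN) : g = d (coordA g) * nil (coordN g) := by
  have h := iwasawa g
  rwa [← one_mul g, compK_mul_of_pos K.one_mem hg, one_mul, one_mul, eq_comm] at h

/-- The decomposition `G = K · AN`, written as `(k, p) ↦ k p⁻¹` so that left translations of the
group `K × AN` become left translations by `K` and right translations by `AN` on `G`. -/
def prodHomeo : K × AN ≃ₜ SU11 where
  toFun x := x.1 * (x.2 : SU11)⁻¹
  invFun g := (⟨compK g, compK_mem g⟩, ⟨((compK g)⁻¹ * g)⁻¹, by
    obtain ⟨θ, t, ξ, rfl⟩ := exists_iwasawa g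
    rw [compK_iwasawa, mul_assoc, inv_mul_cancel_left]
    refine AN.inv_mem (mem_AN_iff.2 ?_)
    rw [rowSum_d_mul_nil, Complex.norm_real, Real.norm_of_nonneg (Real.exp_pos _).le]⟩)
  left_inv x := by
    obtain ⟨k, p⟩ := x
    have h : compK (k * (p : SU11)⁻¹) = k := compK_mul_of_pos k.2 (AN.inv_mem p.2)
    ext : 2
    · exact h
    · simp only [h]; group
  right_inv g := by simp
  continuous_toFun := by fun_prop
  continuous_invFun := by fun_prop

theorem prodHomeo_symm_isMulLeftInvariant {ν : Measure SU11}
    (hK : ∀ θ, ν.map (u θ * ·) = ν) (hA : ∀ t, ν.map (· * d t) = ν)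
    (hN : ∀ ξ, ν.map (· * nil ξ) = ν) :
    (ν.map prodHomeo.symm).IsMulLeftInvariant := by
  refine ⟨fun x => ?_⟩
  obtain ⟨k, p⟩ := x
  obtain ⟨θ, rfl⟩ := exists_uK_eq k
  have h : (fun y => ((uK θ, p) : K × AN) * y) ∘ prodHomeo.symm =
      prodHomeo.symm ∘ ((u θ * ·) ∘ (· * (p : SU11)⁻¹)) := by
    funext g
    apply prodHomeo.injective
    obtain ⟨y, rfl⟩ := prodHomeo.surjective g
    simp [prodHomeo, uK, mul_assoc]
  have hp : ν.map (· * (p : SU11)⁻¹) = ν := by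
    have h1 := eq_of_mem_AN (AN.inv_mem p.2)
    rw [h1]
    have h2 : (fun g : SU11 => g * (d (coordA (p : SU11)⁻¹) * nil (coordN (p : SU11)⁻¹))) =
        (· * nil (coordN (p : SU11)⁻¹)) ∘ (· * d (coordA (p : SU11)⁻¹)) := by
      funext g; simp [mul_assoc]
    rw [h2, ← Measure.map_map (measurable_mul_const _) (measurable_mul_const _), hA, hN]
  rw [Measure.map_map (by fun_prop) prodHomeo.symm.measurable, h,
    ← Measure.map_map prodHomeo.symm.measurable
      ((measurable_const_mul _).comp (measurable_mul_const _)),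
    ← Measure.map_map (measurable_const_mul _) (measurable_mul_const _), hp, hK]

/-- Both measures become left-invariant on the group `K × AN`, so they are proportional by uniqueness
of Haar measure. -/
theorem haarG_eq_smul_haar :
    ∃ c : NNReal, c ≠ 0 ∧ haarG = c • (Measure.haar (G := SU11)) := by
  have := haar_isMulRightInvariant
  have : LocallyCompactSpace (K × AN) := prodHomeo.isOpenEmbedding.locallyCompactSpace
  have h1 : (haarG.map prodHomeo.symm).IsMulLeftInvariant :=
    prodHomeo_symm_isMulLeftInvariant map_mul_left_u map_mul_right_d map_mul_right_nil
  have h2 : ((Measure.haar (G := SU11)).map prodHomeo.symm).IsMulLeftInvariant :=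
    prodHomeo_symm_isMulLeftInvariant (fun _ => map_mul_left_eq_self _ _)
      (fun _ => map_mul_right_eq_self _ _) (fun _ => map_mul_right_eq_self _ _)
  have h3 : IsFiniteMeasureOnCompacts (haarG.map prodHomeo.symm) :=
    Measure.IsFiniteMeasureOnCompacts.map _ _
  have h4 : IsFiniteMeasureOnCompacts ((Measure.haar (G := SU11)).map prodHomeo.symm) :=
    Measure.IsFiniteMeasureOnCompacts.map _ _
  have h5 : ((Measure.haar (G := SU11)).map prodHomeo.symm).IsOpenPosMeasure :=
    prodHomeo.symm.continuous.isOpenPosMeasure_map prodHomeo.symm.surjective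
  have h6 : ((Measure.haar (G := SU11)).map prodHomeo.symm).IsHaarMeasure := {}
  obtain ⟨c, h7⟩ : ∃ c : NNReal, haarG.map prodHomeo.symm =
      c • (Measure.haar (G := SU11)).map prodHomeo.symm :=
    ⟨_, Measure.isMulLeftInvariant_eq_smul _ _⟩
  have h8 := congrArg (fun ν => ν.map prodHomeo) h7
  simp only [Measure.map_smul, Measure.map_map prodHomeo.measurable prodHomeo.symm.measurable,
    Homeomorph.self_comp_symm, Measure.map_id] at h8
  refine ⟨c, ?_, h8⟩
  rintro rfl
  rw [zero_smul] at h8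
  exact haarG_ne_zero h8

instance isHaarMeasure_haarG : haarG.IsHaarMeasure := by
  obtain ⟨c, hc, h⟩ := haarG_eq_smul_haar
  rw [h]
  exact Measure.IsHaarMeasure.nnreal_smul _ hc

instance isMulRightInvariant_haarG : haarG.IsMulRightInvariant := by
  obtain ⟨c, hc, h⟩ := haarG_eq_smul_haar
  have := haar_isMulRightInvariant
  rw [h]
  infer_instance

/-! ### Integrability of compactly supported continuous functions -/

/-- On `X × ℝ`, a continuous function whose support lies over a compact subset of `X` is integrable
over any bounded interval in the second variable. -/
theorem integrable_prod_Ioc {X : Type*} [TopologicalSpace X] [SecondCountableTopology X]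
    [T2Space X] [MeasurableSpace X] [BorelSpace X] {ν : Measure X} [SFinite ν]
    [IsFiniteMeasureOnCompacts ν] {F : X × ℝ → ℂ} (hF : Continuous F) {C : Set X}
    (hC : IsCompact C) (h0 : ∀ x θ, x ∉ C → F (x, θ) = 0) (a b : ℝ) :
    Integrable F (ν.prod (volume.restrict (Set.Ioc a b))) := by
  have h1 : IntegrableOn F (C ×ˢ Set.Icc a b) (ν.prod volume) := by
    have hc : IsCompact (C ×ˢ Set.Icc a b) := hC.prod isCompact_Icc
    obtain ⟨M, hM⟩ := hc.exists_bound_of_continuousOn hF.continuousOn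
    refine IntegrableOn.of_bound ?_ hF.aestronglyMeasurable M
      ((ae_restrict_iff' hc.measurableSet).2 (Filter.Eventually.of_forall hM))
    rw [Measure.prod_prod]
    exact ENNReal.mul_lt_top hC.measure_lt_top isCompact_Icc.measure_lt_top
  have h2 : IntegrableOn F (Set.univ ×ˢ Set.Ioc a b) (ν.prod volume) := by
    refine h1.of_forall_sdiff_eq_zero (MeasurableSet.univ.prod measurableSet_Ioc) ?_
    rintro ⟨x, θ⟩ ⟨⟨-, hθ⟩, hx⟩
    exact h0 x θ fun hxC => hx ⟨hxC, Set.Ioc_subset_Icc_self hθ⟩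
  rwa [IntegrableOn, ← Measure.prod_restrict, Measure.restrict_univ] at h2

/-! ### The characters of `ℂˣ` behind the transform -/

/-- The complex number `c` with `μ (t S_x) = c t`. -/
def slope (μ : LieA →ₗ[ℝ] ℂ) : ℂ := μ ⟨Sx, Submodule.mem_span_singleton_self Sx⟩

theorem logA_dA_eq (t : ℝ) : logA (dA t) = t • ⟨Sx, Submodule.mem_span_singleton_self Sx⟩ :=
  Subtype.ext (logA_dA t)

theorem map_logA_dA (μ : LieA →ₗ[ℝ] ℂ) (t : ℝ) : μ (logA (dA t)) = t * slope μ := by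
  rw [logA_dA_eq, map_smul, Complex.real_smul, slope]

theorem rho_logA_dA (t : ℝ) : rho (logA (dA t)) = t / 2 := by
  change ((logA (dA t) : Matrix (Fin 2) (Fin 2) ℂ) 0 1).re = _
  rw [logA_dA]
  simp [Sx]
  ring

/-- The quasi-character `z ↦ (z / |z|)ᵐ |z| ^ (2c)` of `ℂˣ`. -/
def quasiChar (m : ℤ) (c z : ℂ) : ℂ := (z / ‖z‖) ^ m * Complex.exp (Real.log (‖z‖ ^ 2) * c)

theorem quasiChar_mul (m : ℤ) (c : ℂ) {z w : ℂ} (hz : z ≠ 0) (hw : w ≠ 0) :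
    quasiChar m c (z * w) = quasiChar m c z * quasiChar m c w := by
  have h1 := norm_ne_zero_iff.2 hz
  have h2 := norm_ne_zero_iff.2 hw
  rw [quasiChar, quasiChar, quasiChar, norm_mul, mul_pow, Real.log_mul (by positivity)
    (by positivity), Complex.ofReal_add, add_mul, Complex.exp_add, Complex.ofReal_mul,
    mul_div_mul_comm, mul_zpow]
  ring

theorem quasiChar_of_norm_eq_one (m : ℤ) (c : ℂ) {z : ℂ} (hz : ‖z‖ = 1) :
    quasiChar m c z = z ^ m := by
  simp [quasiChar, hz]

theorem quasiChar_ofReal_exp (m : ℤ) (c : ℂ) (t : ℝ) :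
    quasiChar m c (Real.exp (t / 2) : ℝ) = Complex.exp (t * c) := by
  have h : ‖((Real.exp (t / 2) : ℝ) : ℂ)‖ = Real.exp (t / 2) := by
    rw [Complex.norm_real, Real.norm_of_nonneg (Real.exp_pos _).le]
  rw [quasiChar, h, div_self (by exact_mod_cast (Real.exp_pos _).ne'), _root_.one_zpow, one_mul,
    ← Real.exp_nat_mul, Real.log_exp]
  congr 2
  push_cast
  ring

theorem _root_.Continuous.quasiChar {X : Type*} [TopologicalSpace X] {f : X → ℂ}
    (hf : Continuous f) (h0 : ∀ x, f x ≠ 0) (m : ℤ) (c : ℂ) :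
    Continuous (fun x => quasiChar m c (f x)) := by
  have h1 : ∀ x, ‖f x‖ ≠ 0 := fun x => norm_ne_zero_iff.2 (h0 x)
  have h2 : ∀ x, (‖f x‖ : ℂ) ≠ 0 := fun x => Complex.ofReal_ne_zero.2 (h1 x)
  unfold QuasiBoson.quasiChar
  refine Continuous.mul ?_ ?_
  · exact (hf.div (Complex.continuous_ofReal.comp hf.norm) h2).zpow₀ m
      fun x => Or.inl (div_ne_zero (h0 x) (h2 x))
  · exact Complex.continuous_exp.comp ((Complex.continuous_ofReal.comp
      ((hf.norm.pow 2).log fun x => pow_ne_zero 2 (h1 x))).mul continuous_const)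

theorem norm_quasiChar (m : ℤ) (c : ℂ) {z : ℂ} (hz : z ≠ 0) :
    ‖quasiChar m c z‖ = Real.exp (Real.log (‖z‖ ^ 2) * c.re) := by
  have h1 := norm_ne_zero_iff.2 hz
  rw [quasiChar, norm_mul, norm_zpow, norm_div, Complex.norm_real, norm_norm, div_self h1,
    _root_.one_zpow, one_mul, Complex.norm_exp, Complex.re_ofReal_mul]

/-- The function `u_θ d_t n_ξ ↦ exp (-imθ/2) exp (c t)` on `G`. -/
def weight (m : ℤ) (c : ℂ) (g : SU11) : ℂ := quasiChar m c (star (rowSum g))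

theorem star_rowSum_ne_zero (g : SU11) : star (rowSum g) ≠ 0 :=
  star_ne_zero.2 (rowSum_ne_zero g)

theorem continuous_weight (m : ℤ) (c : ℂ) : Continuous (weight m c) :=
  continuous_rowSum.star.quasiChar star_rowSum_ne_zero m c

theorem chi_uK_eq (m : ℤ) (θ : ℝ) : chi m (uK θ) = alpha (u θ) ^ m := rfl

theorem star_alpha_u (θ : ℝ) : star (alpha (u θ)) = (alpha (u θ))⁻¹ := by
  rw [Complex.inv_def, Complex.normSq_eq_norm_sq, norm_alpha_u]
  simp

theorem alpha_u_ne_zero (θ : ℝ) : alpha (u θ) ≠ 0 := by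
  rw [← norm_ne_zero_iff, norm_alpha_u]; exact one_ne_zero

theorem weight_iwasawa (m : ℤ) (c : ℂ) (θ t ξ : ℝ) :
    weight m c (u θ * d t * nil ξ) =
      Complex.exp (-(Complex.I * ((m : ℂ) / 2) * θ)) * Complex.exp (t * c) := by
  rw [weight, rowSum_iwasawa, star_mul, Complex.star_def, Complex.conj_ofReal, ← Complex.star_def,
    quasiChar_mul _ _ (star_ne_zero.2 (alpha_u_ne_zero θ))
      (Complex.ofReal_ne_zero.2 (Real.exp_pos _).ne'), quasiChar_ofReal_exp,
    quasiChar_of_norm_eq_one _ _ (by rw [norm_star, norm_alpha_u]), star_alpha_u,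
    _root_.inv_zpow, ← chi_uK_eq, chi_uK, ← Complex.exp_neg]

/-! ### The circle averages -/

/-- The integral of the quasi-character over the circle with centre `a` and radius `|b|`, traversed
twice. -/
def circleAvg (m : ℤ) (c a b : ℂ) : ℂ :=
  ∫ θ in (0 : ℝ)..(4 * Real.pi), quasiChar m c (a + b * Complex.exp (Complex.I * θ))

theorem circleAvg_mul_exp (m : ℤ) (c a b : ℂ) (φ : ℝ) :
    circleAvg m c a (b * Complex.exp (Complex.I * φ)) = circleAvg m c a b := by
  have hper : Function.Periodic
      (fun θ : ℝ => quasiChar m c (a + b * Complex.exp (Complex.I * θ))) (4 * Real.pi) := by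
    intro θ
    have : Complex.exp (Complex.I * ((θ + 4 * Real.pi : ℝ) : ℂ)) =
        Complex.exp (Complex.I * θ) := by
      rw [show Complex.I * ((θ + 4 * Real.pi : ℝ) : ℂ) = Complex.I * θ +
        2 * Real.pi * Complex.I + 2 * Real.pi * Complex.I by push_cast; ring, Complex.exp_periodic,
        Complex.exp_periodic]
    simp only [this]
  have h1 := hper.intervalIntegral_add_eq φ 0
  rw [zero_add] at h1
  rw [circleAvg, circleAvg, ← h1]
  have h2 := intervalIntegral.integral_comp_add_left (a := 0) (b := 4 * Real.pi)
    (fun θ : ℝ => quasiChar m c (a + b * Complex.exp (Complex.I * θ))) φ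
  rw [add_zero] at h2
  rw [← h2]
  refine intervalIntegral.integral_congr fun θ _ => ?_
  simp only [mul_assoc, ← Complex.exp_add]
  congr 4
  push_cast
  ring

/-- The average depends on `b` only through `|b|`. -/
theorem circleAvg_congr (m : ℤ) (c a : ℂ) {b b' : ℂ} (h : ‖b‖ = ‖b'‖) :
    circleAvg m c a b = circleAvg m c a b' := by
  have key : ∀ b : ℂ, circleAvg m c a b = circleAvg m c a (‖b‖ : ℂ) := by
    intro b
    conv_lhs => rw [← Complex.norm_mul_exp_arg_mul_I b, mul_comm (b.arg : ℂ)]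
    exact circleAvg_mul_exp _ _ _ _ _
  rw [key b, key b', h]

theorem add_mul_exp_ne_zero {a b : ℂ} (hab : ‖b‖ < ‖a‖) (θ : ℝ) :
    a + b * Complex.exp (Complex.I * θ) ≠ 0 := by
  intro h
  have h1 : ‖a‖ = ‖b‖ := by
    rw [eq_neg_of_add_eq_zero_left h, norm_neg, norm_mul, mul_comm Complex.I,
      Complex.norm_exp_ofReal_mul_I, mul_one]
  exact hab.ne' h1

theorem circleAvg_mul_left (m : ℤ) (c : ℂ) {z a b : ℂ} (hz : z ≠ 0) (hab : ‖b‖ < ‖a‖) :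
    circleAvg m c (z * a) (z * b) = quasiChar m c z * circleAvg m c a b := by
  rw [circleAvg, circleAvg, ← intervalIntegral.integral_const_mul]
  refine intervalIntegral.integral_congr fun θ _ => ?_
  rw [← quasiChar_mul _ _ hz (add_mul_exp_ne_zero hab θ), mul_add, mul_assoc]

/-! ### The transform as an integral over the group -/

theorem integrable_iwasawa_of_fixed {H : SU11 → ℂ} (hH : Continuous H) (hc : HasCompactSupport H)
    {χ : ℝ → ℂ} (hχ : Continuous χ) (t : ℝ) :
    Integrable (fun p : ℝ × ℝ => H (u p.1 * d t * nil p.2) * χ p.1)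
      ((volume.restrict (Set.Ioc 0 (4 * Real.pi))).prod volume) := by
  have h := integrable_prod_Ioc (ν := (volume : Measure ℝ))
    (F := fun p : ℝ × ℝ => H (u p.2 * d t * nil p.1) * χ p.2) (by fun_prop)
    (hc.image continuous_coordN) (fun ξ θ hξ => ?_) 0 (4 * Real.pi)
  · exact h.swap
  · have h0 : H (u θ * d t * nil ξ) = 0 := image_eq_zero_of_notMem_tsupport fun hm =>
      hξ ⟨_, hm, coordN_iwasawa _ _ _⟩
    simp only [h0, zero_mul]

/-- The exchange of the first two coordinates of `ℝ³`. -/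
def swapEquiv : ℝ × ℝ × ℝ ≃ᵐ ℝ × ℝ × ℝ :=
  MeasurableEquiv.prodAssoc.symm.trans
    ((MeasurableEquiv.prodComm.prodCongr (MeasurableEquiv.refl ℝ)).trans MeasurableEquiv.prodAssoc)

theorem swapEquiv_apply (p : ℝ × ℝ × ℝ) : swapEquiv p = (p.2.1, p.1, p.2.2) := rfl

theorem measurePreserving_swapEquiv (α β γ : Measure ℝ) [SFinite α] [SFinite β] [SFinite γ] :
    MeasurePreserving swapEquiv (α.prod (β.prod γ)) (β.prod (α.prod γ)) :=
  ((measurePreserving_prodAssoc α β γ).symm _).trans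
    ((Measure.measurePreserving_swap.prod (MeasurePreserving.id γ)).trans
      (measurePreserving_prodAssoc β α γ))

theorem integrable_iwasawa {H : SU11 → ℂ} (hH : Continuous H) (hc : HasCompactSupport H) :
    Integrable (fun p : ℝ × ℝ × ℝ => (Real.exp p.1 : ℂ) * H (u p.2.1 * d p.1 * nil p.2.2))
      (volume.prod ((volume.restrict (Set.Ioc 0 (4 * Real.pi))).prod volume)) := by
  have h := integrable_prod_Ioc (ν := (volume : Measure (ℝ × ℝ)))
    (F := fun p : (ℝ × ℝ) × ℝ => (Real.exp p.1.1 : ℂ) * H (u p.2 * d p.1.1 * nil p.1.2))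
    (by fun_prop) ((hc.image continuous_coordA).prod (hc.image continuous_coordN))
    (fun ξ θ hξ => ?_) 0 (4 * Real.pi)
  · exact (measurePreserving_swapEquiv _ _ _).integrable_comp_of_integrable h.swap
  · have h0 : H (u θ * d ξ.1 * nil ξ.2) = 0 := image_eq_zero_of_notMem_tsupport fun hm =>
      hξ ⟨⟨_, hm, coordA_iwasawa _ _ _⟩, ⟨_, hm, coordN_iwasawa _ _ _⟩⟩
    simp only [h0, mul_zero]

/-- The integral over `G` in Iwasawa coordinates, with the `A`-coordinate outermost. -/
theorem integral_haarG {H : SU11 → ℂ} (hH : Continuous H) :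
    ∫ g, H g ∂haarG = (1 / (4 * Real.pi) : ℝ) *
      ∫ p : ℝ × ℝ × ℝ, (Real.exp p.1 : ℂ) * H (u p.2.1 * d p.1 * nil p.2.2)
      ∂(volume.prod ((volume.restrict (Set.Ioc 0 (4 * Real.pi))).prod volume)) := by
  have hm : Measurable (fun t : ℝ => ENNReal.ofReal (Real.exp t)) := by fun_prop
  rw [haarG, integral_smul_measure, integral_map continuous_iwasawa.aemeasurable
    hH.aestronglyMeasurable, prod_withDensity_left hm, prod_withDensity_right (by fun_prop),
    integral_withDensity_eq_integral_toReal_smul (by fun_prop) (by simp),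
    ← (measurePreserving_swapEquiv _ _ _).integral_comp',
    ENNReal.toReal_ofReal (by positivity), Complex.real_smul, restrict_Ico_eq_restrict_Ioc]
  congr 1
  refine integral_congr_ae (Filter.Eventually.of_forall fun p => ?_)
  simp only [swapEquiv_apply, ENNReal.toReal_ofReal (Real.exp_pos _).le, Complex.real_smul]

theorem abelTransform_mul_eq {f : SU11 → ℂ} (hf : Continuous f) (hc : HasCompactSupport f)
    (hbar : ℝ) (m : ℤ) (μ : LieA →ₗ[ℝ] ℂ) (t : ℝ) :
    abelTransform hbar m f t * (Real.exp (t / 2) : ℂ) * Complex.exp (μ (logA (dA t))) =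
      ((hbar * (1 / (4 * Real.pi)) : ℝ) : ℂ) *
      ∫ p : ℝ × ℝ, (Real.exp t : ℂ) * (f (u p.1 * d t * nil p.2) *
        weight m (slope μ) (u p.1 * d t * nil p.2))
      ∂((volume.restrict (Set.Ioc 0 (4 * Real.pi))).prod volume) := by
  have h := integrable_iwasawa_of_fixed hf hc
    (χ := fun θ => Complex.exp (-(Complex.I * ((m : ℂ) / 2) * θ))) (by fun_prop) t
  rw [abelTransform, intervalIntegral.integral_of_le (by positivity),
    ← integral_prod _ h, map_logA_dA]
  simp_rw [weight_iwasawa, ← mul_assoc, integral_mul_const, mul_assoc (Real.exp t : ℂ),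
    integral_const_mul]
  rw [show Real.exp t = Real.exp (t / 2) * Real.exp (t / 2) by rw [← Real.exp_add]; ring_nf]
  push_cast
  ring

theorem integrable_abelTransform {f : SU11 → ℂ} (hf : Continuous f) (hc : HasCompactSupport f)
    (hbar : ℝ) (m : ℤ) (μ : LieA →ₗ[ℝ] ℂ) :
    Integrable (fun t : ℝ => abelTransform hbar m f t * (Real.exp (t / 2) : ℂ) *
      Complex.exp (μ (logA (dA t)))) := by
  simp_rw [abelTransform_mul_eq hf hc]
  exact ((integrable_iwasawa (hf.mul (continuous_weight m (slope μ)))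
    hc.mul_right).integral_prod_left).const_mul _

theorem sphericalFourier_eq {f : SU11 → ℂ} (hf : Continuous f) (hc : HasCompactSupport f)
    (hbar : ℝ) (m : ℤ) (μ : LieA →ₗ[ℝ] ℂ) :
    sphericalFourier hbar m μ f = hbar * ∫ g, f g * weight m (slope μ) g ∂haarG := by
  have hw : Continuous fun g => f g * weight m (slope μ) g :=
    hf.mul (continuous_weight m (slope μ))
  rw [sphericalFourier, integral_haarG hw, integral_prod _ (integrable_iwasawa hw hc.mul_right)]
  simp_rw [abelTransform_mul_eq hf hc]
  rw [integral_const_mul]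
  push_cast
  ring

/-! ### The spherical function -/

theorem alpha_u_sq (θ : ℝ) : alpha (u θ) * alpha (u θ) = Complex.exp (Complex.I * θ) := by
  rw [alpha_u, ← Complex.exp_add]
  congr 1
  push_cast
  ring

theorem integrable_mul_quasiChar {f : SU11 → ℂ} (hf : Continuous f) (hc : HasCompactSupport f)
    {a b : SU11 → ℂ} (ha : Continuous a) (hb : Continuous b) (hab : ∀ g, ‖b g‖ < ‖a g‖)
    (m : ℤ) (c : ℂ) :
    Integrable (fun p : SU11 × ℝ =>
        f p.1 * quasiChar m c (a p.1 + b p.1 * Complex.exp (Complex.I * p.2)))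
      (haarG.prod (volume.restrict (Set.Ioc 0 (4 * Real.pi)))) := by
  have h1 : Continuous fun p : SU11 × ℝ => a p.1 + b p.1 * Complex.exp (Complex.I * p.2) := by
    fun_prop
  have h2 : Continuous fun p : SU11 × ℝ =>
      f p.1 * quasiChar m c (a p.1 + b p.1 * Complex.exp (Complex.I * p.2)) :=
    (hf.comp continuous_fst).mul
      (h1.quasiChar (fun p => add_mul_exp_ne_zero (hab p.1) p.2) m c)
  refine integrable_prod_Ioc h2 (C := tsupport f) hc (fun g θ hg => ?_) 0 (4 * Real.pi)
  simp only [image_eq_zero_of_notMem_tsupport hg, zero_mul]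

/-- If the integral of `f` against the quasi-character of `a + b ζ` does not depend on `ζ` on the unit
circle, it may be averaged over `ζ`. -/
theorem integral_mul_circleAvg {f : SU11 → ℂ} (hf : Continuous f) (hc : HasCompactSupport f)
    {a b : SU11 → ℂ} (ha : Continuous a) (hb : Continuous b) (hab : ∀ g, ‖b g‖ < ‖a g‖)
    (m : ℤ) (c : ℂ) {I : ℂ}
    (h : ∀ θ : ℝ, ∫ g, f g * quasiChar m c (a g + b g * Complex.exp (Complex.I * θ)) ∂haarG = I) :
    ∫ g, f g * circleAvg m c (a g) (b g) ∂haarG = 4 * Real.pi * I := by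
  have h1 := intervalIntegral_integral_swap (μ := haarG) (a := 0) (b := 4 * Real.pi)
    (f := fun θ g => f g * quasiChar m c (a g + b g * Complex.exp (Complex.I * θ))) (by
      rw [Set.uIoc_of_le (by positivity)]
      exact (integrable_mul_quasiChar hf hc ha hb hab m c).swap)
  simp_rw [h, intervalIntegral.integral_const_mul] at h1
  simp_rw [circleAvg, ← h1]
  simp

theorem KNat_mul_right {m : ℤ} {f : SU11 → ℂ} (hf : f ∈ KNat m) (g : SU11) (k : K) :
    f (g * k) = f g * chi m k := by
  have := hf.2.2 1 k g
  simpa [chi] using this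

theorem KNat_mul_left {m : ℤ} {f : SU11 → ℂ} (hf : f ∈ KNat m) (g : SU11) (k : K) :
    f (k * g) = chi m k * f g := by
  have := hf.2.2 k 1 g
  simpa [chi] using this

/-- Right translation by `u_θ` and the type of `f` replace the weight by its average over `K`. -/
theorem integral_mul_circleAvg_eq_weight {m : ℤ} {f : SU11 → ℂ} (hf : f ∈ KNat m) (c : ℂ) :
    ∫ g, f g * circleAvg m c (star (alpha g)) (-beta g) ∂haarG =
      4 * Real.pi * ∫ g, f g * weight m c g ∂haarG := by
  have h0 : ∀ g : SU11, circleAvg m c (star (alpha g)) (-beta g) =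
      circleAvg m c (star (alpha g)) (star (beta g)) := fun g =>
    circleAvg_congr m c _ (by rw [norm_neg, norm_star])
  simp_rw [h0]
  -- the integral for the angle `θ` is `∫ f w` after the translation `g ↦ g u_θ`
  refine integral_mul_circleAvg hf.1 hf.2.1 (by fun_prop) (by fun_prop)
    (fun g => by rw [norm_star, norm_star]; exact norm_beta_lt g) m c fun θ => ?_
  rw [← integral_mul_right_eq_self (fun g => f g * weight m c g) (u θ)]
  refine integral_congr_ae (Filter.Eventually.of_forall fun g => ?_)
  have h1 : f (g * u θ) = f g * alpha (u θ) ^ m := KNat_mul_right hf g (uK θ)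
  simp only [h1]
  rw [mul_assoc, weight, ← quasiChar_of_norm_eq_one m c (norm_alpha_u θ),
    ← quasiChar_mul m c (alpha_u_ne_zero θ) (star_rowSum_ne_zero _), rowSum_mul]
  congr 2
  simp only [rowSum, beta_u, add_zero, star_add, star_mul, star_star]
  have h2 : alpha (u θ) * star (alpha (u θ)) = 1 := by
    rw [star_alpha_u, mul_inv_cancel₀ (alpha_u_ne_zero θ)]
  rw [← alpha_u_sq]
  linear_combination (-star (alpha g)) * h2

/-- The product formula: the average over `K` of `k ↦ χ(k) w(y k x)`, for the weight `w`, factors as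
a function of `y` times `w x`. -/
theorem integral_mul_weight_mul {m : ℤ} {f : SU11 → ℂ} (hf : f ∈ KNat m) (c : ℂ) (y : SU11) :
    4 * Real.pi * ∫ x, f x * weight m c (y * x) ∂haarG =
      circleAvg m c (star (alpha y)) (-beta y) * ∫ x, f x * weight m c x ∂haarG := by
  have hy : ‖star (beta y)‖ < ‖star (alpha y)‖ := by
    rw [norm_star, norm_star]; exact norm_beta_lt y
  -- with `r = rowSum x`, the translation `x ↦ u_θ x` turns the weight at `y x` into the
  -- quasi-character of `r̄ ᾱ + r β̄ ζ`
  have h := integral_mul_circleAvg hf.1 hf.2.1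
    (a := fun x => star (rowSum x) * star (alpha y)) (b := fun x => rowSum x * star (beta y))
    (by fun_prop) (by fun_prop) (fun x => by
      rw [norm_mul, norm_mul, norm_star (rowSum x)]
      exact mul_lt_mul_of_pos_left hy (norm_pos_iff.2 (rowSum_ne_zero x))) m c
    (I := ∫ x, f x * weight m c (y * x) ∂haarG) (fun θ => ?_)
  · rw [← h, ← integral_const_mul]
    refine integral_congr_ae (Filter.Eventually.of_forall fun x => ?_)
    have h1 : circleAvg m c (star (rowSum x) * star (alpha y)) (rowSum x * star (beta y)) =
        weight m c x * circleAvg m c (star (alpha y)) (-beta y) := by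
      rw [circleAvg_congr m c _ (b' := star (rowSum x) * star (beta y))
        (by rw [norm_mul, norm_mul, norm_star (rowSum x)]),
        circleAvg_mul_left m c (star_rowSum_ne_zero x) hy, weight,
        circleAvg_congr m c _ (b := star (beta y)) (b' := -beta y) (by rw [norm_neg, norm_star])]
    simp only [h1]
    ring
  · rw [← integral_mul_left_eq_self (fun x => f x * weight m c (y * x)) (u θ)]
    refine integral_congr_ae (Filter.Eventually.of_forall fun x => ?_)
    have h1 : f (u θ * x) = alpha (u θ) ^ m * f x := KNat_mul_left hf x (uK θ)
    simp only [h1]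
    rw [mul_comm (_ ^ m) (f x), mul_assoc (f x), weight, ← quasiChar_of_norm_eq_one m c (norm_alpha_u θ),
      ← quasiChar_mul m c (alpha_u_ne_zero θ) (star_rowSum_ne_zero _), rowSum_mul, rowSum_mul]
    congr 2
    simp only [beta_u, zero_mul, add_zero, star_add, star_mul, star_star]
    have h2 : alpha (u θ) * star (alpha (u θ)) = 1 := by
      rw [star_alpha_u, mul_inv_cancel₀ (alpha_u_ne_zero θ)]
    rw [← alpha_u_sq]
    linear_combination (-star (rowSum x) * star (alpha y)) * h2

/-- The spherical function of type `χ_n`, `n = m / 2`, with spectral parameter `c`: the average over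
the circle of the quasi-character of `α + β ζ`. -/
def sphericalFn (m : ℤ) (c : ℂ) (x : SU11) : ℂ :=
  (1 / (4 * Real.pi) : ℝ) * circleAvg m c (alpha x) (beta x)

theorem sphericalFn_inv (m : ℤ) (c : ℂ) (x : SU11) :
    sphericalFn m c x⁻¹ = (1 / (4 * Real.pi) : ℝ) * circleAvg m c (star (alpha x)) (-beta x) := by
  rw [sphericalFn, alpha_inv, beta_inv]

theorem four_pi_ne_zero : (4 * Real.pi : ℂ) ≠ 0 := by
  simp [Real.pi_ne_zero]

theorem pairing_sphericalFn {m : ℤ} {f : SU11 → ℂ} (hf : f ∈ KNat m) (c : ℂ) :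
    pairing (sphericalFn m c) f = ∫ g, f g * weight m c g ∂haarG := by
  simp_rw [pairing, sphericalFn_inv, mul_left_comm (f _), integral_const_mul,
    integral_mul_circleAvg_eq_weight hf]
  have := four_pi_ne_zero
  push_cast
  field_simp

theorem continuous_sphericalFn (m : ℤ) (c : ℂ) : Continuous (sphericalFn m c) := by
  have h1 : Continuous fun p : SU11 × ℝ =>
      alpha p.1 + beta p.1 * Complex.exp (Complex.I * p.2) := by fun_prop
  have h2 := h1.quasiChar (fun p => add_mul_exp_ne_zero (norm_beta_lt p.1) p.2) m c
  have h3 : Continuous fun x => circleAvg m c (alpha x) (beta x) :=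
    intervalIntegral.continuous_parametric_intervalIntegral_of_continuous'
      (f := fun x θ => quasiChar m c (alpha x + beta x * Complex.exp (Complex.I * θ))) h2
      0 (4 * Real.pi)
  exact continuous_const.mul h3

theorem sphericalFn_mul_K (m : ℤ) (c : ℂ) (x : SU11) (k : K) :
    sphericalFn m c (x * k) = sphericalFn m c x * chi m k := by
  obtain ⟨θ, rfl⟩ := exists_uK_eq k
  change sphericalFn m c (x * u θ) = _
  rw [chi_uK_eq, ← quasiChar_of_norm_eq_one m c (norm_alpha_u θ), sphericalFn, sphericalFn,
    alpha_mul, beta_mul, beta_u, star_zero, mul_zero, mul_zero, add_zero, zero_add,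
    circleAvg_congr m c _ (b' := alpha (u θ) * beta x)
      (by rw [norm_mul, norm_mul, norm_star, mul_comm]), mul_comm (alpha x),
    circleAvg_mul_left m c (alpha_u_ne_zero θ) (norm_beta_lt x)]
  ring

theorem sphericalFn_K_mul (m : ℤ) (c : ℂ) (x : SU11) (k : K) :
    sphericalFn m c (k * x) = chi m k * sphericalFn m c x := by
  obtain ⟨θ, rfl⟩ := exists_uK_eq k
  change sphericalFn m c (u θ * x) = _
  rw [chi_uK_eq, ← quasiChar_of_norm_eq_one m c (norm_alpha_u θ), sphericalFn, sphericalFn,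
    alpha_mul, beta_mul, beta_u, zero_mul, zero_mul, add_zero, add_zero,
    circleAvg_mul_left m c (alpha_u_ne_zero θ) (norm_beta_lt x)]
  ring

theorem chi_inv (m : ℤ) (k : K) : chi m k⁻¹ = (chi m k)⁻¹ := by
  obtain ⟨θ, rfl⟩ := exists_uK_eq k
  change alpha (u θ)⁻¹ ^ m = (alpha (u θ) ^ m)⁻¹
  rw [alpha_inv, star_alpha_u, _root_.inv_zpow]

theorem chi_ne_zero (m : ℤ) (k : K) : chi m k ≠ 0 := by
  obtain ⟨θ, rfl⟩ := exists_uK_eq k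
  exact zpow_ne_zero _ (alpha_u_ne_zero θ)

theorem sphericalFn_one (m : ℤ) (c : ℂ) : sphericalFn m c 1 = 1 := by
  have := four_pi_ne_zero
  rw [sphericalFn, circleAvg, alpha_one, beta_one]
  simp only [zero_mul, add_zero, quasiChar_of_norm_eq_one m c norm_one, _root_.one_zpow,
    intervalIntegral.integral_const, sub_zero, Complex.real_smul, mul_one]
  push_cast
  field_simp

/-! ### Quasi-boundedness -/

/-- The logarithm of the operator norm `|α| + |β|` of `g`. -/
def logNorm (g : SU11) : ℝ := Real.log (‖alpha g‖ + ‖beta g‖)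

theorem one_le_norm_alpha (g : SU11) : 1 ≤ ‖alpha g‖ := by
  have := norm_alpha_sq g
  nlinarith [norm_nonneg (alpha g), sq_nonneg ‖beta g‖]

theorem norm_add_norm_pos (g : SU11) : 0 < ‖alpha g‖ + ‖beta g‖ := by
  have := one_le_norm_alpha g
  have := norm_nonneg (beta g)
  linarith

theorem continuous_logNorm : Continuous logNorm :=
  (continuous_alpha.norm.add continuous_beta.norm).log fun g => (norm_add_norm_pos g).ne'

theorem logNorm_mul_le (x y : SU11) : logNorm (x * y) ≤ logNorm x + logNorm y := by
  rw [logNorm, logNorm, logNorm,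
    ← Real.log_mul (norm_add_norm_pos x).ne' (norm_add_norm_pos y).ne']
  refine Real.log_le_log (norm_add_norm_pos _) ?_
  rw [alpha_mul, beta_mul]
  refine (add_le_add (norm_add_le _ _) (norm_add_le _ _)).trans (le_of_eq ?_)
  simp only [norm_mul, norm_star]
  ring

theorem isGroupSeminorm_exp_logNorm {s : ℝ} (hs : 0 ≤ s) :
    IsGroupSeminorm (fun g => Real.exp (s * logNorm g)) := by
  have hc : Continuous fun g => Real.exp (s * logNorm g) :=
    Real.continuous_exp.comp (continuous_const.mul continuous_logNorm)
  refine ⟨fun x => Real.exp_pos _, hc.lowerSemicontinuous, fun x y => ?_, fun C hC =>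
    (hC.image hc).bddAbove⟩
  rw [← Real.exp_add, ← mul_add]
  exact Real.exp_le_exp.2 (mul_le_mul_of_nonneg_left (logNorm_mul_le x y) hs)

theorem abs_log_norm_sq_le (g : SU11) (θ : ℝ) :
    |Real.log (‖alpha g + beta g * Complex.exp (Complex.I * θ)‖ ^ 2)| ≤ 2 * logNorm g := by
  have hb : ‖beta g * Complex.exp (Complex.I * θ)‖ = ‖beta g‖ := by
    rw [norm_mul, mul_comm Complex.I, Complex.norm_exp_ofReal_mul_I, mul_one]
  have hz := norm_pos_iff.2 (add_mul_exp_ne_zero (norm_beta_lt g) θ)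
  have h1 := norm_add_le (alpha g) (beta g * Complex.exp (Complex.I * θ))
  have h2 := norm_sub_le_norm_add (alpha g) (beta g * Complex.exp (Complex.I * θ))
  rw [hb] at h1 h2
  have hs := norm_add_norm_pos g
  -- `|α| - |β|` is the inverse of `|α| + |β|`
  have h3 : (‖alpha g‖ + ‖beta g‖)⁻¹ ≤ ‖alpha g + beta g * Complex.exp (Complex.I * θ)‖ := by
    refine le_trans (le_of_eq ?_) h2
    exact inv_eq_of_mul_eq_one_right (by linear_combination norm_alpha_sq g)
  rw [Real.log_pow, Nat.cast_ofNat, abs_mul, abs_of_pos (two_pos : (0 : ℝ) < 2), logNorm]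
  refine mul_le_mul_of_nonneg_left (abs_le.2 ⟨?_, Real.log_le_log hz h1⟩) zero_le_two
  rw [← Real.log_inv]
  exact Real.log_le_log (inv_pos.2 hs) h3

theorem quasiBounded_sphericalFn (m : ℤ) (c : ℂ) : QuasiBounded (sphericalFn m c) := by
  refine ⟨_, isGroupSeminorm_exp_logNorm (s := 2 * |c.re|) (by positivity), 1, fun x => ?_⟩
  have h := intervalIntegral.norm_integral_le_of_norm_le_const (a := 0) (b := 4 * Real.pi)
    (f := fun θ : ℝ => quasiChar m c (alpha x + beta x * Complex.exp (Complex.I * θ)))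
    (C := Real.exp (2 * |c.re| * logNorm x)) (fun θ _ => by
      rw [norm_quasiChar _ _ (add_mul_exp_ne_zero (norm_beta_lt x) θ)]
      refine Real.exp_le_exp.2 ((le_abs_self _).trans ?_)
      rw [abs_mul, mul_right_comm]
      exact mul_le_mul_of_nonneg_right (abs_log_norm_sq_le x θ) (abs_nonneg _))
  rw [sub_zero, abs_of_pos (show 0 < 4 * Real.pi by positivity)] at h
  rw [sphericalFn, circleAvg, norm_mul, Complex.norm_real, Real.norm_of_nonneg (by positivity),
    one_mul]
  refine (mul_le_mul_of_nonneg_left h (by positivity)).trans (le_of_eq ?_)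
  have := Real.pi_ne_zero
  field_simp

/-! ### The convolution algebra -/

theorem continuous_conv {f f' : SU11 → ℂ} (hf : Continuous f) (hc : HasCompactSupport f)
    (hf' : Continuous f') : Continuous (conv f f') := by
  rw [← continuousOn_univ]
  refine continuousOn_integral_of_compact_support (f := fun x y => f y * f' (y⁻¹ * x))
    (k := tsupport f) hc ?_ fun x y _ hy => ?_
  · exact Continuous.continuousOn ((hf.comp continuous_snd).mul
      (hf'.comp (continuous_snd.inv.mul continuous_fst)))
  · rw [image_eq_zero_of_notMem_tsupport hy, zero_mul]

theorem hasCompactSupport_conv {f f' : SU11 → ℂ} (hc : HasCompactSupport f)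
    (hc' : HasCompactSupport f') : HasCompactSupport (conv f f') := by
  refine HasCompactSupport.intro (K := (fun p : SU11 × SU11 => p.1 * p.2) ''
    (tsupport f ×ˢ tsupport f')) ((IsCompact.prod hc hc').image continuous_mul) fun x hx => ?_
  refine (integral_congr_ae (Filter.Eventually.of_forall fun y => ?_)).trans (integral_zero _ _)
  by_cases hy : y ∈ tsupport f
  · have : f' (y⁻¹ * x) = 0 := image_eq_zero_of_notMem_tsupport fun h =>
      hx ⟨(y, y⁻¹ * x), ⟨hy, h⟩, mul_inv_cancel_left y x⟩
    simp only [this, mul_zero]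
  · simp only [image_eq_zero_of_notMem_tsupport hy, zero_mul]

theorem conv_mem_KNat {m : ℤ} {f f' : SU11 → ℂ} (hf : f ∈ KNat m) (hf' : f' ∈ KNat m) :
    conv f f' ∈ KNat m := by
  refine ⟨continuous_conv hf.1 hf.2.1 hf'.1, hasCompactSupport_conv hf.2.1 hf'.2.1,
    fun k k' g => ?_⟩
  rw [conv, conv, ← integral_mul_left_eq_self _ (k : SU11), ← integral_const_mul,
    ← integral_mul_const]
  refine integral_congr_ae (Filter.Eventually.of_forall fun y => ?_)
  have h1 : ((k : SU11) * y)⁻¹ * (k * g * k') = y⁻¹ * g * k' := by group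
  simp only [h1, KNat_mul_left hf, KNat_mul_right hf']
  ring

theorem integral_conv_mul {f f' w : SU11 → ℂ} (hf : Continuous f) (hc : HasCompactSupport f)
    (hf' : Continuous f') (hc' : HasCompactSupport f') (hw : Continuous w) :
    ∫ x, conv f f' x * w x ∂haarG = ∫ y, f y * ∫ x, f' x * w (y * x) ∂haarG ∂haarG := by
  have hcont : Continuous fun p : SU11 × SU11 => f p.2 * f' (p.2⁻¹ * p.1) * w p.1 :=
    ((hf.comp continuous_snd).mul (hf'.comp (continuous_snd.inv.mul continuous_fst))).mul
      (hw.comp continuous_fst)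
  have hsupp : HasCompactSupport fun p : SU11 × SU11 => f p.2 * f' (p.2⁻¹ * p.1) * w p.1 := by
    refine HasCompactSupport.intro (K := (fun p : SU11 × SU11 => (p.1 * p.2, p.1)) ''
      (tsupport f ×ˢ tsupport f')) ((IsCompact.prod hc hc').image (by fun_prop)) fun p hp => ?_
    by_cases hy : p.2 ∈ tsupport f
    · have : f' (p.2⁻¹ * p.1) = 0 := image_eq_zero_of_notMem_tsupport fun h =>
        hp ⟨(p.2, p.2⁻¹ * p.1), ⟨hy, h⟩, Prod.ext (mul_inv_cancel_left p.2 p.1) rfl⟩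
      simp only [this, mul_zero, zero_mul]
    · simp only [image_eq_zero_of_notMem_tsupport hy, zero_mul]
  have hint := hcont.integrable_of_hasCompactSupport (μ := haarG.prod haarG) hsupp
  simp_rw [conv, ← integral_mul_const]
  rw [integral_integral_swap (f := fun x y => f y * f' (y⁻¹ * x) * w x) hint]
  refine integral_congr_ae (Filter.Eventually.of_forall fun y => ?_)
  simp only [← integral_const_mul]
  rw [← integral_mul_left_eq_self _ y]
  simp only [inv_mul_cancel_left, mul_assoc]

theorem pairing_conv {m : ℤ} {f f' : SU11 → ℂ} (hf : f ∈ KNat m) (hf' : f' ∈ KNat m) (c : ℂ) :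
    pairing (sphericalFn m c) (conv f f') =
      pairing (sphericalFn m c) f * pairing (sphericalFn m c) f' := by
  have h4 := four_pi_ne_zero
  rw [pairing_sphericalFn (conv_mem_KNat hf hf'), pairing_sphericalFn hf', pairing,
    integral_conv_mul hf.1 hf.2.1 hf'.1 hf'.2.1 (continuous_weight m c), ← integral_mul_const]
  refine integral_congr_ae (Filter.Eventually.of_forall fun y => ?_)
  have h := integral_mul_weight_mul hf' c y
  simp only [sphericalFn_inv]
  rw [mul_assoc, mul_assoc, ← h]
  push_cast
  field_simp

/-! ### Nonvanishing of the functional -/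

/-- A function of type `χ_n` on which the functional of the spherical function `Φ` is positive:
`x ↦ conj (Φ x⁻¹)`, cut off by a function of `|α|`. -/
def testFn (m : ℤ) (c : ℂ) (x : SU11) : ℂ :=
  (max 0 (2 - ‖alpha x‖ ^ 2) : ℝ) * star (sphericalFn m c x⁻¹)

theorem star_chi (m : ℤ) (k : K) : star (chi m k) = (chi m k)⁻¹ := by
  obtain ⟨θ, rfl⟩ := exists_uK_eq k
  rw [chi_uK_eq, star_zpow₀, star_alpha_u, _root_.inv_zpow]

theorem testFn_mem_KNat (m : ℤ) (c : ℂ) : testFn m c ∈ KNat m := by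
  have h1 : Continuous fun x : SU11 => max 0 (2 - ‖alpha x‖ ^ 2) := by fun_prop
  refine ⟨(Complex.continuous_ofReal.comp h1).mul
    ((continuous_sphericalFn m c).comp continuous_inv).star,
    HasCompactSupport.intro (isCompact_norm_alpha_sq_le 2) fun x hx => ?_, fun k k' g => ?_⟩
  · rw [Set.mem_ofPred_eq, not_le] at hx
    rw [testFn, max_eq_left (by linarith), Complex.ofReal_zero, zero_mul]
  · have hα : ‖alpha ((k : SU11) * g * k')‖ = ‖alpha g‖ := by
      obtain ⟨θ, rfl⟩ := exists_uK_eq k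
      obtain ⟨θ', rfl⟩ := exists_uK_eq k'
      exact (norm_alpha_mul_u _ θ').trans (norm_alpha_u_mul g θ)
    have hΦ : sphericalFn m c ((k : SU11) * g * k')⁻¹ =
        (chi m k')⁻¹ * (sphericalFn m c g⁻¹ * (chi m k)⁻¹) := by
      rw [← chi_inv, ← chi_inv, ← sphericalFn_mul_K, ← sphericalFn_K_mul]
      simp [mul_assoc]
    rw [testFn, testFn, hα, hΦ, star_mul, star_mul, star_inv₀, star_inv₀, star_chi, star_chi,
      inv_inv, inv_inv]
    ring

theorem pairing_testFn_ne_zero (m : ℤ) (c : ℂ) :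
    pairing (sphericalFn m c) (testFn m c) ≠ 0 := by
  have h : ∀ x : SU11, testFn m c x * sphericalFn m c x⁻¹ =
      ((max 0 (2 - ‖alpha x‖ ^ 2) * ‖sphericalFn m c x⁻¹‖ ^ 2 : ℝ) : ℂ) := by
    intro x
    rw [testFn, mul_assoc, Complex.star_def, Complex.conj_mul']
    push_cast
    rfl
  simp_rw [pairing, h]
  rw [integral_complex_ofReal, Complex.ofReal_ne_zero]
  refine ne_of_gt (Continuous.integral_pos_of_hasCompactSupport_nonneg_nonzero (x := 1) ?_ ?_ ?_ ?_)
  · have := (continuous_sphericalFn m c).comp continuous_inv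
    exact Continuous.mul (by fun_prop) (this.norm.pow 2)
  · refine HasCompactSupport.intro (isCompact_norm_alpha_sq_le 2) fun x hx => ?_
    rw [Set.mem_ofPred_eq, not_le] at hx
    rw [max_eq_left (by linarith), zero_mul]
  · exact fun x => mul_nonneg (le_max_left _ _) (sq_nonneg _)
  · rw [inv_one, sphericalFn_one, alpha_one]
    norm_num

/-! ### Measures on `K`, `A` and `N` -/

theorem continuous_uK : Continuous uK := continuous_u.subtype_mk _

theorem integral_haarK {H : K → ℂ} (hH : StronglyMeasurable H) :
    ∫ k, H k ∂haarK = (1 / (4 * Real.pi) : ℝ) *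
      ∫ θ in (0 : ℝ)..(4 * Real.pi), H (uK θ) := by
  rw [haarK, integral_smul_measure, integral_map continuous_uK.aemeasurable
    hH.aestronglyMeasurable, ENNReal.toReal_ofReal (by positivity), Complex.real_smul,
    intervalIntegral.integral_of_le (by positivity), integral_Ico_eq_integral_Ioc]

theorem integral_const_haarK (z : ℂ) : ∫ _ : K, z ∂haarK = z := by
  have := four_pi_ne_zero
  rw [integral_haarK stronglyMeasurable_const, intervalIntegral.integral_const, sub_zero,
    Complex.real_smul]
  push_cast
  field_simp

/-- The parametrization `t ↦ d_t` of `A` is a homeomorphism. -/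
def dAHomeo : ℝ ≃ₜ A where
  toFun := dA
  invFun h := coordA h
  left_inv t := by
    have := coordA_iwasawa 0 t 0
    rwa [u_zero, nil_zero, one_mul, mul_one] at this
  right_inv h := by
    obtain ⟨_, ⟨t, rfl⟩⟩ := h
    have := coordA_iwasawa 0 t.toAdd 0
    rw [u_zero, nil_zero, one_mul, mul_one] at this
    exact congrArg dA this
  continuous_toFun := continuous_d.subtype_mk _
  continuous_invFun := by fun_prop

/-- The parametrization `ξ ↦ n_ξ` of `N` is a homeomorphism. -/
def nilNHomeo : ℝ ≃ₜ N where
  toFun := nilN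
  invFun n := coordN n
  left_inv ξ := by
    have := coordN_iwasawa 0 0 ξ
    rwa [u_zero, d_zero, one_mul, one_mul] at this
  right_inv n := by
    obtain ⟨_, ⟨ξ, rfl⟩⟩ := n
    have := coordN_iwasawa 0 0 ξ.toAdd
    rw [u_zero, d_zero, one_mul, one_mul] at this
    exact congrArg nilN this
  continuous_toFun := continuous_nil.subtype_mk _
  continuous_invFun := by fun_prop

theorem integral_haarA (H : A → ℂ) : ∫ h, H h ∂haarA = ∫ t, H (dA t) :=
  integral_map_equiv dAHomeo.toMeasurableEquiv H

theorem integral_haarN (H : N → ℂ) : ∫ n, H n ∂haarN = ∫ ξ, H (nilN ξ) :=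
  integral_map_equiv nilNHomeo.toMeasurableEquiv H

theorem abelType_dA {f : SU11 → ℂ} (hf : Continuous f) (m : ℤ) (t : ℝ) :
    abelType m f (dA t) = abelTransform 1 m f t := by
  have hχ : Continuous fun k : K => chi m k⁻¹ := by
    have h1 : ∀ k : K, alpha ((k⁻¹ : K) : SU11) ≠ 0 := fun k =>
      norm_ne_zero_iff.1 (zero_lt_one.trans_le (one_le_norm_alpha _)).ne'
    exact Continuous.zpow₀ (by fun_prop) m fun k => Or.inl (h1 k)
  have hm : StronglyMeasurable fun k : K =>
      ∫ ξ : ℝ, f ((k : SU11) * d t * nil ξ) * chi m k⁻¹ := by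
    refine StronglyMeasurable.integral_prod_right
      (f := fun (k : K) (ξ : ℝ) => f ((k : SU11) * d t * nil ξ) * chi m k⁻¹) ?_
    exact Continuous.stronglyMeasurable ((hf.comp (by fun_prop)).mul (hχ.comp continuous_fst))
  have hN : ∀ k : K, ∫ n : N, f ((k : SU11) * (dA t : SU11) * (n : SU11)) * chi m k⁻¹ ∂haarN =
      ∫ ξ : ℝ, f ((k : SU11) * d t * nil ξ) * chi m k⁻¹ := fun k => integral_haarN _
  have hθ : ∀ θ : ℝ, chi m (uK θ)⁻¹ = Complex.exp (-(Complex.I * ((m : ℂ) / 2) * θ)) := by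
    intro θ
    rw [chi_inv, chi_uK, ← Complex.exp_neg]
  rw [abelType, rho_logA_dA, abelTransform]
  simp_rw [hN]
  rw [integral_haarK hm]
  simp_rw [hθ]
  change _ * (_ * ∫ θ in (0 : ℝ)..(4 * Real.pi), ∫ ξ : ℝ, f (u θ * d t * nil ξ) * _) = _
  push_cast
  ring

theorem isSpherical_sphericalFn (m : ℤ) (c : ℂ) : IsSpherical m (sphericalFn m c) where
  continuous := continuous_sphericalFn m c
  quasiBounded := quasiBounded_sphericalFn m c
  central k x := by
    have h := sphericalFn_mul_K m c ((k : SU11) * x) k⁻¹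
    rw [sphericalFn_K_mul, chi_inv, mul_right_comm, mul_inv_cancel₀ (chi_ne_zero m k),
      one_mul] at h
    exact h
  left_type x := by
    have h : ∀ k : K, chi m k * sphericalFn m c ((k : SU11)⁻¹ * x) = sphericalFn m c x := by
      intro k
      have := sphericalFn_K_mul m c x k⁻¹
      rw [chi_inv] at this
      rw [← Subgroup.coe_inv, this, mul_inv_cancel_left₀ (chi_ne_zero m k)]
    simp_rw [h, integral_const_haarK]
  right_type x := by
    have h : ∀ k : K, sphericalFn m c (x * (k : SU11)⁻¹) * chi m k = sphericalFn m c x := by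
      intro k
      have := sphericalFn_mul_K m c x k⁻¹
      rw [chi_inv] at this
      rw [← Subgroup.coe_inv, this, inv_mul_cancel_right₀ (chi_ne_zero m k)]
    simp_rw [h, integral_const_haarK]
  mul f hf f' hf' := ⟨conv_mem_KNat hf hf', pairing_conv hf hf' c⟩
  nonzero := ⟨testFn m c, testFn_mem_KNat m c, pairing_testFn_ne_zero m c⟩

theorem isKangniType_sphericalFourier (m : ℤ) (μ : LieA →ₗ[ℝ] ℂ) :
    IsKangniType m μ (sphericalFourier 1 m μ) := by
  refine ⟨⟨sphericalFn m (slope μ), isSpherical_sphericalFn m _, fun f hf => ?_⟩, fun f hf => ?_⟩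
  · rw [sphericalFourier_eq hf.1 hf.2.1, pairing_sphericalFn hf, Complex.ofReal_one, one_mul]
  · rw [sphericalFourier, integral_haarA]
    refine integral_congr_ae (Filter.Eventually.of_forall fun t => ?_)
    simp only [abelType_dA hf.1, rho_logA_dA, Complex.exp_add, Complex.ofReal_exp]
    ring

theorem integrand_eq (m : ℤ) (μ : LieA →ₗ[ℝ] ℂ) (f : SU11 → ℂ) (g : SU11) (θ : ℝ) :
    ((-(beta g * Complex.exp (Complex.I * θ)) + star (alpha g)) /
      (‖star (alpha g) - beta g * Complex.exp (Complex.I * θ)‖ : ℂ)) ^ m * f g *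
      Complex.exp (μ (logA (dA (Real.log
        (‖star (alpha g) - beta g * Complex.exp (Complex.I * θ)‖ ^ 2))))) =
    f g * quasiChar m (slope μ) (star (alpha g) + -beta g * Complex.exp (Complex.I * θ)) := by
  rw [map_logA_dA, quasiChar, neg_mul, ← sub_eq_add_neg, neg_add_eq_sub]
  ring

end QuasiBoson

end

open QuasiBoson in
theorem mainTheorem7 (m : ℤ) (μ : LieA →ₗ[ℝ] ℂ) (h hbar : ℝ) (hh : hbar = h / (2 * Real.pi)) :
    haarG.IsHaarMeasure ∧
    (∀ f ∈ KNat m,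
      (∀ t : ℝ, Integrable
        (fun p : ℝ × ℝ => f (u p.1 * d t * nil p.2) *
          Complex.exp (-(Complex.I * ((m : ℂ) / 2) * p.1)))
        ((volume.restrict (Set.Ioc 0 (4 * Real.pi))).prod volume)) ∧
      Integrable (fun t : ℝ => abelTransform hbar m f t * (Real.exp (t / 2) : ℂ) *
        Complex.exp (μ (logA (dA t)))) ∧
      Integrable
        (fun p : SU11 × ℝ =>
          ((-(beta p.1 * Complex.exp (Complex.I * p.2)) + star (alpha p.1)) /
            (‖star (alpha p.1) - beta p.1 * Complex.exp (Complex.I * p.2)‖ : ℂ)) ^ m *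
          f p.1 *
          Complex.exp (μ (logA (dA (Real.log
            (‖star (alpha p.1) - beta p.1 * Complex.exp (Complex.I * p.2)‖ ^ 2))))))
        (haarG.prod (volume.restrict (Set.Ioc 0 (4 * Real.pi)))) ∧
      sphericalFourier hbar m μ f =
        ((h / (8 * Real.pi ^ 2) : ℝ) : ℂ) *
          ∫ g : SU11, (∫ θ in (0 : ℝ)..(4 * Real.pi),
            ((-(beta g * Complex.exp (Complex.I * θ)) + star (alpha g)) /
              (‖star (alpha g) - beta g * Complex.exp (Complex.I * θ)‖ : ℂ)) ^ m *
            f g *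
            Complex.exp (μ (logA (dA (Real.log
              (‖star (alpha g) - beta g * Complex.exp (Complex.I * θ)‖ ^ 2)))))) ∂haarG) ∧
    (hbar = 1 → IsKangniType m μ (sphericalFourier hbar m μ)) := by
  refine ⟨isHaarMeasure_haarG, fun f hf => ⟨fun t => ?_, ?_, ?_, ?_⟩, ?_⟩
  · exact integrable_iwasawa_of_fixed hf.1 hf.2.1
      (χ := fun θ => Complex.exp (-(Complex.I * ((m : ℂ) / 2) * θ))) (by fun_prop) t
  · exact integrable_abelTransform hf.1 hf.2.1 hbar m μ
  · simp_rw [integrand_eq]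
    exact integrable_mul_quasiChar hf.1 hf.2.1 (a := fun g => star (alpha g))
      (b := fun g => -beta g) (by fun_prop) (by fun_prop)
      (fun g => by rw [norm_neg, norm_star]; exact norm_beta_lt g) m (slope μ)
  · simp_rw [integrand_eq, intervalIntegral.integral_const_mul]
    change _ = _ * ∫ g, f g * circleAvg m (slope μ) (star (alpha g)) (-beta g) ∂haarG
    rw [integral_mul_circleAvg_eq_weight hf, sphericalFourier_eq hf.1 hf.2.1, hh]
    have h1 : (Real.pi : ℂ) ≠ 0 := Complex.ofReal_ne_zero.2 Real.pi_ne_zero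
    push_cast
    field_simp
    ring
  · rintro rfl
    exact isKangniType_sphericalFourier m μ
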